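/- **Setting.** There are $m$ agents, a horizon $H\ge 1$ and a layered state space $\mathcal S_1,\dots,\mathcal S_{H+1}$ (arbitrary, possibly infinite sets) with initial state $s_1\in\mathcal S_1$. Agent $i$ has a finite non-empty action set $\mathcal A^i$, and $\mathcal A=\prod_i\mathcal A^i$. The transition probabilities $\mathbb P(\cdot\mid s,\boldsymbol a)$, $s\in\mathcal S_h$, are discrete distributions on $\mathcal S_{h+1}$, and the losses satisfy $\ell^i(s,\boldsymbol a)\in[0,1]$. For a joint policy $\pi$, write $\pi^{-i}$ for the marginal policy of the agents other than $i$. **Independent linear function approximation.** Let $d\ge 1$ and let $\phi:\mathcal S\times\mathcal A^i\to\mathbb R^d$ (one map for each $i$) satisfy $\|\phi(s,a)\|_2\le 1$. Let $\Pi^{\rm est}$ be a set of policies such that for all $\pi\in\Pi^{\rm est}$, $i\in[m]$, $h\in[H]$ there are $\mu=\mu^i_{\pi^{-i}}:\mathcal S_{h+1}\to\mathbb R^d$ and $\nu=\nu^i_{\pi^{-i}}(h)\in\mathbb R^d$ with $$\mathbb E[\mathbb P(s'\mid s,\boldsymbol a)]=\phi(s,a)^{\mathsf T}\mu(s'),\qquad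 \mathbb E[\ell^i(s,\boldsymbol a)]=\phi(s,a)^{\mathsf T}\nu\qquad(s\in\mathcal S_h,\ a\in\mathcal A^i,\ s'\in\mathcal S_{h+1}),$$ where the expectations are over $\boldsymbol a^{i}=a$, $\boldsymbol a^{-i}\sim\pi^{-i}(\cdot\mid s)$, and with $\|\nu\|_2\le\sqrt d$ and $\|\sum_{s'}f(s')\mu(s')\|_2\le\sqrt d$ for every finitely supported $f:\mathcal S_{h+1}\to[-1,1]$. **The subroutine.** Fix a layer $h\in[H]$, a roll-in policy $\bar\pi$ (the uniform mixture of finitely many Markov joint policies, one of which is drawn for each episode), next-layer value functions $\bar V^i:\mathcal S_{h+1}\to[0,H-h]$, a number of rounds $K\ge 1$, $\eta\in\mathbb R$, $\delta\in(0,1)$, $\beta_1,\beta_2$, and $\gamma=\frac{5d}{K}\log\frac{6d}{\delta}$. 1. Draw two batches of $K$ independent layer-$h$ samples (state and joint action) from $\bar\pi$, the cov batch $(s_\kappa^{\rm cov},\boldsymbol a_\kappa^{\rm cov})$ and the mag batch $(s_\kappa^{\rm mag},\boldsymbol a_\kappa^{\rm mag})$. Write $a_{\kappa,i}$ for the action of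 agent $i$, and put $\hat\Sigma_i^\dagger=\big(\frac1K\sum_{\kappa}\phi(s_\kappa^{\rm cov},a_{\kappa,i}^{\rm cov})\phi(s_\kappa^{\rm cov},a_{\kappa,i}^{\rm cov})^{\mathsf T}+\gamma I\big)^{-1}$. 2. The bonus of agent $i$ is $$B^i(s,a)=\beta_1\,\phi(s,a)^{\mathsf T}\hat\Sigma_i^\dagger\phi(s,a)+\beta_2\sum_{j=1}^d\ \sup_{(s',a')\in\mathcal S_h\times\mathcal A^i}\phi(s,a)[j]\,(\hat\Sigma_i^\dagger\phi(s',a'))[j],$$ in which $\phi(s,a)[j]$ may be taken out of the supremum when it is nonnegative. 3. In round $k=1,\dots,K$, agent $i$ uses $\pi_k^i(a\mid s)\propto\exp\big(-\eta\sum_{\kappa<k}(\hat Q^i_\kappa(s,a)-B^i(s,a))\big)$, and $\pi_k=\prod_i\pi_k^i$. For each $i$, independently given the past, one episode is played in which all agents follow $\bar\pi$, except that in layer $h$ the agents $j\ne i$ follow $\pi_k^{-i}$. Agent $i$ records its state and action $(s_{k}^i,a_{k}^i)$, its loss $\ell_{k}^i$ and the next state $\bar s_{k}^{\,i}$, and sets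 $\hat\theta_k^i=\hat\Sigma_i^\dagger\phi(s_{k}^i,a_{k}^i)(\ell_{k}^i+\bar V^i(\bar s_{k}^{\,i}))$ and, with $(x)_-=\min\{x,0\}$, $$\hat Q_k^i(s,a)=\phi(s,a)^{\mathsf T}\hat\theta_k^i-H\big(\phi(s,a)^{\mathsf T}\hat\Sigma_i^\dagger\phi(s_k^i,a_k^i)\big)_-+\frac HK\sum_{\kappa=1}^K\big(\phi(s,a)^{\mathsf T}\hat\Sigma_i^\dagger\phi(s^{\rm mag}_\kappa,a^{\rm mag}_{\kappa,i})\big)_-.$$ Assume that all policies $\pi_k$ that can occur in such an execution belong to $\Pi^{\rm est}$. Let $\theta_k^i\in\mathbb R^d$ be such that $\phi(s,a)^{\mathsf T}\theta_k^i=\mathbb E_{\boldsymbol a^i=a,\ \boldsymbol a^{-i}\sim\pi_k^{-i}(\cdot\mid s)}[(\ell^i+\mathbb P\bar V^i)(s,\boldsymbol a)]$ for all $s\in\mathcal S_h$, $a\in\mathcal A^i$. **Theorem.** There are universal constants $c,C>0$ such that in every such situation with $$\beta_1\ge c\,\frac{dH}{\sqrt K}\log\frac{6mdHK}{\delta},\qquad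 \beta_2\ge c\,\frac HK\log\frac{6mdHK}{\delta},$$ with probability at least $1-2\delta$ over the execution, simultaneously for all $i\in[m]$, all $s\in\mathcal S_h$ and all distributions $\pi_*^i(\cdot\mid s)$ on $\mathcal A^i$ (in particular for a best response, which depends on the execution), $$\underbrace{\sum_{k=1}^K\sum_{a\in\mathcal A^i}\pi_*^i(a\mid s)\,\phi(s,a)^{\mathsf T}(\hat\theta_k^i-\theta_k^i)}_{\text{Bias-2}}\ \underbrace{-\sum_{k=1}^K\sum_{a\in\mathcal A^i}\pi_*^i(a\mid s)\,B^i(s,a)}_{\text{Bonus-2}}\ \le\ C\,\frac d{\beta_1}\log\frac{dK}{\delta}.$$ -/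

import Mathlib

universe u v

open scoped Matrix ENNReal

noncomputable section

/-! ### Discrete probability -/

/-- Expectation of a real function under a discrete distribution. -/
def pmfExp {α : Type*} (p : PMF α) (f : α → ℝ) : ℝ := ∑' x, (p x).toReal * f x

/-- Product of finitely many discrete distributions (independent draws). -/
def pmfPi : {n : ℕ} → {α : Fin n → Type u} → (∀ i, PMF (α i)) → PMF (∀ i, α i)
  | 0, _, _ => PMF.pure (fun i => i.elim0)
  | _ + 1, _, p => (p 0).bind fun x => (pmfPi fun i => p i.succ).map (Fin.cons x)

theorem pmfPi_apply {n : ℕ} {α : Fin n → Type u} (p : ∀ i, PMF (α i)) (x : ∀ i, α i) :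
    pmfPi p x = ∏ i, p i (x i) := by
  classical
  induction n with
  | zero =>
    have : x = fun i => i.elim0 := funext fun i => i.elim0
    simp [pmfPi, this]
  | succ n ih =>
    rw [Fin.prod_univ_succ, pmfPi, PMF.bind_apply, tsum_eq_single (x 0)]
    · congr 1
      rw [PMF.map_apply, tsum_eq_single (Fin.tail x)]
      · rw [if_pos (Fin.cons_self_tail x).symm, ih]
        rfl
      · intro y hy
        rw [if_neg]
        intro h
        apply hy
        rw [h]
        rfl
    · intro y hy
      rw [PMF.map_apply]
      convert mul_zero _
      refine ENNReal.tsum_eq_zero.2 fun z => if_neg ?_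
      intro h
      apply hy
      rw [h]
      rfl

/-- The distribution with `p(a) ∝ exp (f a)` on a finite set. -/
def softmaxPMF {α : Type*} [Fintype α] [Nonempty α] (f : α → ℝ) : PMF α :=
  PMF.normalize (fun a => ENNReal.ofReal (Real.exp (f a)))
    (by
      rw [tsum_fintype]
      intro h
      have := Finset.sum_eq_zero_iff.1 h (Classical.arbitrary α) (Finset.mem_univ _)
      exact absurd (ENNReal.ofReal_eq_zero.1 this) (not_le.2 (Real.exp_pos _)))
    (by
      rw [tsum_fintype]
      exact ENNReal.sum_ne_top.2 fun a _ => ENNReal.ofReal_ne_top)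

/-! ### Markov games -/

/-- An `m`-agent general-sum Markov game of horizon `H`. The state space is layered; the layers
are indexed from `0` to `H`, so layer `h` here is the `(h+1)`-st layer when counted from one. -/
structure MarkovGame (m H : ℕ) (S : Fin (H + 1) → Type u) (A : Fin m → Type v) where
  init : S 0
  P : ∀ h : Fin H, S h.castSucc → (∀ i, A i) → PMF (S h.succ)
  loss : ∀ (_ : Fin m) (h : Fin H), S h.castSucc → (∀ i, A i) → ℝ
  loss_mem : ∀ i h s a, loss i h s a ∈ Set.Icc (0 : ℝ) 1

/-- A joint (possibly correlated) policy on one layer with state set `X`. -/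
abbrev LayerPolicy {m : ℕ} (X : Type u) (A : Fin m → Type v) := X → PMF (∀ i, A i)

/-- A Markov joint policy. -/
abbrev JointPolicy {m : ℕ} (H : ℕ) (S : Fin (H + 1) → Type u) (A : Fin m → Type v) :=
  ∀ h : Fin H, LayerPolicy (S h.castSucc) A

/-- Law of the joint action when agent `i` plays `a` and the other agents follow the
marginal `ρ⁻ⁱ(· ∣ s)` of the joint policy `ρ`. -/
def deviate {m : ℕ} {X : Type u} {A : Fin m → Type v} (ρ : LayerPolicy X A) (i : Fin m) (s : X)
    (a : A i) : PMF (∀ j, A j) :=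
  (ρ s).map fun b => Function.update b i a

namespace MarkovGame

variable {m H : ℕ} {S : Fin (H + 1) → Type u} {A : Fin m → Type v}

/-- Law of the state in each layer when all agents follow `π`. -/
def stateLaw (G : MarkovGame m H S A) (π : JointPolicy H S A) : (h : Fin (H + 1)) → PMF (S h) :=
  Fin.induction (motive := fun h => PMF (S h)) (PMF.pure G.init)
    (fun h p => p.bind fun s => (π h s).bind fun a => G.P h s a)

/-- Law of the state and the joint action in layer `h` when all agents follow `π`. -/
def layerLaw (G : MarkovGame m H S A) (π : JointPolicy H S A) (h : Fin H) :
    PMF (S h.castSucc × (∀ i, A i)) :=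
  (G.stateLaw π h.castSucc).bind fun s => (π h s).map fun a => (s, a)

/-- Law of the state and the joint action in layer `h` under the uniform mixture of `n + 1`
policies: one of them is drawn at the start of the episode and followed by all the agents. -/
def mixLaw (G : MarkovGame m H S A) {n : ℕ} (mix : Fin (n + 1) → JointPolicy H S A) (h : Fin H) :
    PMF (S h.castSucc × (∀ i, A i)) :=
  (PMF.uniformOfFintype (Fin (n + 1))).bind fun t => G.layerLaw (mix t) h

/-- The function `(ℓⁱ + P V)(s, a)` for `V` on the next layer. -/
def backup (G : MarkovGame m H S A) (i : Fin m) (h : Fin H) (V : S h.succ → ℝ)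
    (s : S h.castSucc) (a : ∀ j, A j) : ℝ :=
  G.loss i h s a + pmfExp (G.P h s a) V

/-- Independent linear function approximation with respect to the feature maps `φ` and the set
`Pest` of policies (given layer by layer). The bound on the vector-valued measure `μ` of the next
layer is that `‖∫ f dμ‖₂ ≤ √d` for all `f` with values in `[-1, 1]`; it is written with finitely
supported `f`, so that summability of `μ` is a consequence. -/
def IndependentLinear {d : ℕ} (G : MarkovGame m H S A)
    (φ : ∀ (i : Fin m) (h : Fin H), S h.castSucc → A i → Fin d → ℝ)
    (Pest : ∀ h : Fin H, Set (LayerPolicy (S h.castSucc) A)) : Prop :=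
  (∀ i h s a, ‖WithLp.toLp 2 (φ i h s a)‖ ≤ 1) ∧
  ∀ (i : Fin m) (h : Fin H), ∀ ρ ∈ Pest h,
    ∃ (μ : S h.succ → Fin d → ℝ) (ν : Fin d → ℝ),
      (∀ s a s', (((deviate ρ i s a).bind (G.P h s)) s').toReal = φ i h s a ⬝ᵥ μ s') ∧
      (∀ s a, pmfExp (deviate ρ i s a) (G.loss i h s) = φ i h s a ⬝ᵥ ν) ∧
      (∀ (F : Finset (S h.succ)) (f : S h.succ → ℝ), (∀ y, |f y| ≤ 1) →
        ‖WithLp.toLp 2 (∑ y ∈ F, f y • μ y)‖ ≤ Real.sqrt d) ∧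
      ‖WithLp.toLp 2 ν‖ ≤ Real.sqrt d

end MarkovGame

/-! ### The CCE-Approx subroutine -/

/-- What an agent with actions `B` records in one episode of a learning round, in a layer with
states `X` and next states `Y`. -/
structure Obs (X Y : Type u) (B : Type v) where
  state : X
  action : B
  loss : ℝ
  next : Y

/-- The data of one call of the subroutine on layer `h`: the game, the features, the roll-in
policy (a uniform mixture), the next-layer value functions, and the numerical parameters. -/
structure CCECall (m d H : ℕ) (S : Fin (H + 1) → Type u) (A : Fin m → Type v) where
  game : MarkovGame m H S A
  φ : ∀ (i : Fin m) (h : Fin H), S h.castSucc → A i → Fin d → ℝ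
  h : Fin H
  n : ℕ
  mix : Fin (n + 1) → JointPolicy H S A
  Vbar : Fin m → S h.succ → ℝ
  K : ℕ
  η : ℝ
  β₁ : ℝ
  β₂ : ℝ
  δ : ℝ

namespace CCECall

variable {m d H : ℕ} {S : Fin (H + 1) → Type u} {A : Fin m → Type v}

/-- States of the current layer. -/
abbrev X (Γ : CCECall m d H S A) : Type u := S Γ.h.castSucc

/-- A batch of `K` roll-in samples (state and joint action in the current layer). -/
abbrev Batch (Γ : CCECall m d H S A) : Type (max u v) := Fin Γ.K → Γ.X × (∀ i, A i)

/-- The records of all the agents in one learning round. -/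
abbrev Round (Γ : CCECall m d H S A) : Type (max u v) :=
  ∀ i : Fin m, Obs Γ.X (S Γ.h.succ) (A i)

/-- A full execution: the covariance batch, the magnitude-reduction batch, and `K` rounds. -/
abbrev Run (Γ : CCECall m d H S A) : Type (max u v) :=
  Γ.Batch × Γ.Batch × (Fin Γ.K → Γ.Round)

/-- The feature of agent `i` in the current layer. -/
def feat (Γ : CCECall m d H S A) (i : Fin m) (s : Γ.X) (a : A i) : Fin d → ℝ := Γ.φ i Γ.h s a

/-- `γ = (5 d / K) log (6 d / δ)`. -/
def γ (Γ : CCECall m d H S A) : ℝ := 5 * d / Γ.K * Real.log (6 * d / Γ.δ)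

/-- `Σ̂† = (K⁻¹ ∑ φ φᵀ + γ I)⁻¹`, from the covariance batch. -/
def sigmaInv (Γ : CCECall m d H S A) (cov : Γ.Batch) (i : Fin m) : Matrix (Fin d) (Fin d) ℝ :=
  ((1 / (Γ.K : ℝ)) • ∑ κ, Matrix.vecMulVec (Γ.feat i (cov κ).1 ((cov κ).2 i))
      (Γ.feat i (cov κ).1 ((cov κ).2 i)) + Γ.γ • (1 : Matrix (Fin d) (Fin d) ℝ))⁻¹

/-- `θ̂ = Σ̂† φ(s, a) (ℓ + V̄(s'))`, from one record of agent `i`. -/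
def thetaHat (Γ : CCECall m d H S A) (cov : Γ.Batch) (i : Fin m)
    (o : Obs Γ.X (S Γ.h.succ) (A i)) : Fin d → ℝ :=
  (o.loss + Γ.Vbar i o.next) • (Γ.sigmaInv cov i *ᵥ Γ.feat i o.state o.action)

/-- The magnitude-reduced estimator `Q̂`, where `(x)₋ = min x 0`. -/
def qHat (Γ : CCECall m d H S A) (cov mag : Γ.Batch) (i : Fin m)
    (o : Obs Γ.X (S Γ.h.succ) (A i)) (s : Γ.X) (a : A i) : ℝ :=
  Γ.feat i s a ⬝ᵥ Γ.thetaHat cov i o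
    - H * min (Γ.feat i s a ⬝ᵥ (Γ.sigmaInv cov i *ᵥ Γ.feat i o.state o.action)) 0
    + H / Γ.K * ∑ κ, min (Γ.feat i s a ⬝ᵥ
        (Γ.sigmaInv cov i *ᵥ Γ.feat i (mag κ).1 ((mag κ).2 i))) 0

/-- The action-dependent bonus
`B(s, a) = β₁ ‖φ(s,a)‖²_{Σ̂†} + β₂ ∑ⱼ sup_{(s',a')} φ(s,a)[j] (Σ̂† φ(s',a'))[j]`. -/
def bonus (Γ : CCECall m d H S A) (cov : Γ.Batch) (i : Fin m) (s : Γ.X) (a : A i) : ℝ :=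
  Γ.β₁ * (Γ.feat i s a ⬝ᵥ (Γ.sigmaInv cov i *ᵥ Γ.feat i s a))
    + Γ.β₂ * ∑ j, ⨆ p : Γ.X × A i,
        Γ.feat i s a j * (Γ.sigmaInv cov i *ᵥ Γ.feat i p.1 p.2) j

/-- For features with nonnegative coordinates, the coordinate can be taken out of the supremum. -/
theorem bonus_eq_of_nonneg (Γ : CCECall m d H S A) (cov : Γ.Batch) (i : Fin m) (s : Γ.X)
    (a : A i) (hφ : ∀ j, 0 ≤ Γ.feat i s a j) :
    Γ.bonus cov i s a =
      Γ.β₁ * (Γ.feat i s a ⬝ᵥ (Γ.sigmaInv cov i *ᵥ Γ.feat i s a))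
        + Γ.β₂ * ∑ j, Γ.feat i s a j *
            ⨆ p : Γ.X × A i, (Γ.sigmaInv cov i *ᵥ Γ.feat i p.1 p.2) j := by
  unfold bonus
  congr 2
  exact Finset.sum_congr rfl fun j _ => (Real.mul_iSup_of_nonneg (hφ j) _).symm

section Law

variable [∀ i, Fintype (A i)] [∀ i, Nonempty (A i)]

/-- The exponential-weights policy of agent `i` after the rounds `o`:
`πⁱ(a ∣ s) ∝ exp (-η ∑ (Q̂(s, a) - B(s, a)))`. -/
def agentPolicy (Γ : CCECall m d H S A) (cov mag : Γ.Batch) {k : ℕ} (o : Fin k → Γ.Round)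
    (i : Fin m) (s : Γ.X) : PMF (A i) :=
  softmaxPMF fun a => -Γ.η * ∑ κ, (Γ.qHat cov mag i (o κ i) s a - Γ.bonus cov i s a)

/-- All agents draw their actions independently from their current policies. -/
def layerPolicy (Γ : CCECall m d H S A) (cov mag : Γ.Batch) {k : ℕ} (o : Fin k → Γ.Round) :
    LayerPolicy Γ.X A :=
  fun s => pmfPi fun i => Γ.agentPolicy cov mag o i s

/-- Law of the record of agent `i` in an episode in which all agents follow the roll-in policy,
except that in the current layer the agents other than `i` follow `ρ`. -/
def obsLaw (Γ : CCECall m d H S A) (ρ : LayerPolicy Γ.X A) (i : Fin m) :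
    PMF (Obs Γ.X (S Γ.h.succ) (A i)) :=
  (Γ.game.mixLaw Γ.mix Γ.h).bind fun z =>
    (deviate ρ i z.1 (z.2 i)).bind fun a =>
      (Γ.game.P Γ.h z.1 a).map fun y => ⟨z.1, z.2 i, Γ.game.loss i Γ.h z.1 a, y⟩

/-- Law of the first `k` learning rounds, given the two batches; in each round there is one
episode for each agent. -/
def roundsLaw (Γ : CCECall m d H S A) (cov mag : Γ.Batch) : (k : ℕ) → PMF (Fin k → Γ.Round)
  | 0 => PMF.pure (fun κ => κ.elim0)
  | k + 1 => (Γ.roundsLaw cov mag k).bind fun o =>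
      (pmfPi fun i => Γ.obsLaw (Γ.layerPolicy cov mag o) i).map fun r =>
        Fin.snoc (α := fun _ => Γ.Round) o r

/-- Law of a full execution. -/
def runLaw (Γ : CCECall m d H S A) : PMF Γ.Run :=
  (pmfPi fun _ : Fin Γ.K => Γ.game.mixLaw Γ.mix Γ.h).bind fun cov =>
    (pmfPi fun _ : Fin Γ.K => Γ.game.mixLaw Γ.mix Γ.h).bind fun mag =>
      (Γ.roundsLaw cov mag Γ.K).map fun o => (cov, mag, o)

/-- The joint policy `π_k` of round `k` of an execution; it depends on the earlier rounds only. -/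
def policyAt (Γ : CCECall m d H S A) (ω : Γ.Run) (k : Fin Γ.K) : LayerPolicy Γ.X A :=
  Γ.layerPolicy ω.1 ω.2.1 (fun κ : Fin k => ω.2.2 (Fin.castLE k.isLt.le κ))

/-- `Q_kⁱ(s, a) = E[(ℓⁱ + P V̄ⁱ)(s, 𝐚)]` with `𝐚ⁱ = a` and `𝐚⁻ⁱ ∼ π_k⁻ⁱ(· ∣ s)`. -/
def qTrue (Γ : CCECall m d H S A) (ω : Γ.Run) (k : Fin Γ.K) (i : Fin m) (s : Γ.X) (a : A i) : ℝ :=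
  pmfExp (deviate (Γ.policyAt ω k) i s a) (Γ.game.backup i Γ.h (Γ.Vbar i) s)

/-- A vector `θ_kⁱ` with `φ(s, a)ᵀ θ_kⁱ = Q_kⁱ(s, a)` for all `s` and `a`. -/
def thetaTrue (Γ : CCECall m d H S A) (ω : Γ.Run) (k : Fin Γ.K) (i : Fin m) : Fin d → ℝ :=
  Classical.epsilon fun θ => ∀ s a, Γ.feat i s a ⬝ᵥ θ = Γ.qTrue ω k i s a

/-- `∑ₖ ∑ₐ π⋆(a) φ(s, a)ᵀ (θ̂_kⁱ - θ_kⁱ)`. -/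
def bias2 (Γ : CCECall m d H S A) (ω : Γ.Run) (i : Fin m) (s : Γ.X) (πstar : PMF (A i)) : ℝ :=
  ∑ k, ∑ a, (πstar a).toReal *
    (Γ.feat i s a ⬝ᵥ (Γ.thetaHat ω.1 i (ω.2.2 k i) - Γ.thetaTrue ω k i))

/-- The bonus term as it enters the regret decomposition: `-∑ₖ ∑ₐ π⋆(a) B_kⁱ(s, a)`. -/
def bonus2 (Γ : CCECall m d H S A) (ω : Γ.Run) (i : Fin m) (s : Γ.X) (πstar : PMF (A i)) : ℝ :=
  -∑ _k : Fin Γ.K, ∑ a, (πstar a).toReal * Γ.bonus ω.1 i s a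

end Law

end CCECall

end

noncomputable section

/-! ### Expectations under discrete distributions -/

/-! More holds than is stated: with high probability the left side is at most zero, in every
direction φ = φ(s, a) at once. Let Σ be the roll-in second moment matrix, Σ̂ its empirical version,
W = Σ̂ + γI, x = W⁻¹φ and q = φᵀW⁻¹φ. The summed error ∑ₖ φᵀ(θ̂ₖ - θₖ) splits into a martingale, the
sampling errors xᵀ(Σ - Σ̂)θₖ and the regularisation errors -γ xᵀθₖ. Each is naturally of order √q,
whereas the bonus supplies at least Kβ₁q.

The exchange of √q for q costs no additive remainder because q is bounded below. Transition
probabilities sum to one, so integrating the constant 1 against μ gives a vector w with φ(s, a)ᵀw =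
1 everywhere and wᵀw ≤ d (`exists_unit_vector`). Then wᵀWw ≤ 1 + γd, and Cauchy-Schwarz for W yields
1 ≤ q(1 + γd), hence √q ≤ q√(1 + γd). `sum_estimation_error_le` turns this into a bound K ·
1000(dH/√K)L · q, treating K ≤ d, d ≤ K ≤ d² and d² ≤ K differently.

Uniformity over infinitely many states and directions comes from finite dimension: Bernstein's
inequality is applied to finitely many coordinates in a basis that whitens the relevant quadratic
form, and Cauchy-Schwarz transfers the result to all vectors. This is the mechanism of
`sampleForm_concentration` (covariance batch) and of `scoreDev_concentration` (learning rounds,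
conditionally on the batches). The magnitude batch only influences the policies, so it has no bad
event. -/

/-- Expectation of a function with values in `[0, ∞]` under a discrete distribution. -/
def pmfLExp {α : Type*} (p : PMF α) (F : α → ℝ≥0∞) : ℝ≥0∞ := ∑' x, p x * F x

section LExp

variable {α β : Type*}

theorem pmfLExp_pure (a : α) (F : α → ℝ≥0∞) : pmfLExp (PMF.pure a) F = F a := by
  classical
  unfold pmfLExp
  rw [tsum_eq_single a]
  · simp
  · intro b hb
    simp [hb]

theorem pmfLExp_bind (p : PMF α) (q : α → PMF β) (F : β → ℝ≥0∞) :
    pmfLExp (p.bind q) F = pmfLExp p fun x => pmfLExp (q x) F := by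
  unfold pmfLExp
  simp only [PMF.bind_apply, ← ENNReal.tsum_mul_right, ← ENNReal.tsum_mul_left]
  rw [ENNReal.tsum_comm]
  simp only [mul_assoc]

theorem pmfLExp_map (p : PMF α) (g : α → β) (F : β → ℝ≥0∞) :
    pmfLExp (p.map g) F = pmfLExp p fun x => F (g x) := by
  rw [PMF.map, pmfLExp_bind]
  simp [pmfLExp_pure]

theorem pmfLExp_const (p : PMF α) (c : ℝ≥0∞) : (pmfLExp p fun _ => c) = c := by
  unfold pmfLExp
  rw [ENNReal.tsum_mul_right, p.tsum_coe, one_mul]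

theorem pmfLExp_mono (p : PMF α) {F G : α → ℝ≥0∞} (h : ∀ x, F x ≤ G x) :
    pmfLExp p F ≤ pmfLExp p G :=
  ENNReal.tsum_le_tsum fun x => mul_le_mul_right (h x) _

theorem pmfLExp_const_mul (p : PMF α) (c : ℝ≥0∞) (F : α → ℝ≥0∞) :
    (pmfLExp p fun x => c * F x) = c * pmfLExp p F := by
  unfold pmfLExp
  rw [← ENNReal.tsum_mul_left]
  exact tsum_congr fun x => by ring

/-- Markov's inequality. -/
theorem toOuterMeasure_le_pmfLExp (p : PMF α) {s : Set α} {F : α → ℝ≥0∞}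
    (h : ∀ x ∈ s, 1 ≤ F x) : p.toOuterMeasure s ≤ pmfLExp p F := by
  rw [PMF.toOuterMeasure_apply]
  refine ENNReal.tsum_le_tsum fun x => ?_
  by_cases hx : x ∈ s
  · rw [Set.indicator_of_mem hx]
    exact le_mul_of_one_le_right' (h x hx)
  · rw [Set.indicator_of_notMem hx]
    exact zero_le

/-- Law of total probability: on `B` the inner probability is at most one, off `B` it is at most
`b`. This lets the later stages of an execution be analysed only for good covariance batches. -/
theorem toOuterMeasure_bind_le (p : PMF α) (q : α → PMF β) (s : Set β) (B : Set α) {a b : ℝ≥0∞}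
    (hB : p.toOuterMeasure B ≤ a) (hq : ∀ x, x ∉ B → (q x).toOuterMeasure s ≤ b) :
    (p.bind q).toOuterMeasure s ≤ a + b := by
  classical
  rw [PMF.toOuterMeasure_bind_apply]
  calc ∑' x, p x * (q x).toOuterMeasure s ≤ ∑' x, (B.indicator p x + p x * b) := by
        refine ENNReal.tsum_le_tsum fun x => ?_
        by_cases hx : x ∈ B
        · rw [Set.indicator_of_mem hx]
          refine le_trans ?_ le_self_add
          refine mul_le_of_le_one_right' ?_
          rw [PMF.toOuterMeasure_apply]
          refine le_trans (ENNReal.tsum_le_tsum fun y => ?_) (q x).tsum_coe.le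
          exact Set.indicator_le_self _ _ _
        · rw [Set.indicator_of_notMem hx, zero_add]
          exact mul_le_mul_right (hq x hx) _
    _ ≤ a + b := by
        rw [ENNReal.tsum_add, ENNReal.tsum_mul_right, p.tsum_coe, one_mul,
          ← PMF.toOuterMeasure_apply]
        gcongr

theorem toOuterMeasure_add_compl (p : PMF α) (s : Set α) :
    p.toOuterMeasure s + p.toOuterMeasure sᶜ = 1 := by
  rw [PMF.toOuterMeasure_apply, PMF.toOuterMeasure_apply, ← ENNReal.tsum_add, ← p.tsum_coe]
  exact tsum_congr fun x => congrFun (Set.indicator_self_add_compl s p) x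

theorem toOuterMeasure_iUnion_le {ι : Type*} [Fintype ι] (p : PMF α) (s : ι → Set α) {a : ℝ≥0∞}
    (h : ∀ i, p.toOuterMeasure (s i) ≤ a) :
    p.toOuterMeasure (⋃ i, s i) ≤ Fintype.card ι * a := by
  refine (MeasureTheory.measure_iUnion_fintype_le _ _).trans ?_
  refine (Finset.sum_le_sum fun i _ => h i).trans ?_
  simp

/-- Expectation of a product of functions of independent coordinates. -/
theorem pmfLExp_pmfPi_prod {n : ℕ} {α : Fin n → Type u} (p : ∀ i, PMF (α i))
    (F : ∀ i, α i → ℝ≥0∞) :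
    (pmfLExp (pmfPi p) fun x => ∏ i, F i (x i)) = ∏ i, pmfLExp (p i) (F i) := by
  induction n with
  | zero => simp [pmfPi, pmfLExp_pure]
  | succ n ih =>
    rw [pmfPi, pmfLExp_bind, Fin.prod_univ_succ, ← ih (fun i => p i.succ) fun i => F i.succ]
    simp only [pmfLExp_map, Fin.prod_univ_succ, Fin.cons_zero, Fin.cons_succ, pmfLExp_const_mul]
    rw [mul_comm, ← pmfLExp_const_mul]
    congr 1
    ext x
    rw [mul_comm]

/-- Take every other factor of the product formula equal to one. It isolates the record of one agent
within a round. -/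
theorem pmfLExp_pmfPi_single {n : ℕ} {α : Fin n → Type u} (p : ∀ i, PMF (α i)) (i : Fin n)
    (F : α i → ℝ≥0∞) : (pmfLExp (pmfPi p) fun x => F (x i)) = pmfLExp (p i) F := by
  classical
  have := pmfLExp_pmfPi_prod p
    (Function.update (fun i (_ : α i) => (1 : ℝ≥0∞)) i F)
  rw [Finset.prod_eq_single i] at this
  · rw [Function.update_self] at this
    rw [← this]
    congr 1
    ext x
    rw [Finset.prod_eq_single i]
    · rw [Function.update_self]
    · intro j _ hj
      rw [Function.update_of_ne hj]
    · simp
  · intro j _ hj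
    rw [Function.update_of_ne hj, pmfLExp_const]
  · simp

end LExp

/-- Boundedness of a real function. -/
def IsBdd {α : Type*} (f : α → ℝ) : Prop := ∃ b, ∀ x, |f x| ≤ b

namespace IsBdd

variable {α : Type*} {f g : α → ℝ}

theorem of_abs_le {b : ℝ} (h : ∀ x, |f x| ≤ b) : IsBdd f := ⟨b, h⟩

theorem const (c : ℝ) : IsBdd fun _ : α => c := ⟨|c|, fun _ => le_rfl⟩

theorem add (hf : IsBdd f) (hg : IsBdd g) : IsBdd fun x => f x + g x := by
  obtain ⟨a, ha⟩ := hf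
  obtain ⟨b, hb⟩ := hg
  exact ⟨a + b, fun x => (abs_add_le _ _).trans (add_le_add (ha x) (hb x))⟩

theorem mul (hf : IsBdd f) (hg : IsBdd g) : IsBdd fun x => f x * g x := by
  obtain ⟨a, ha⟩ := hf
  obtain ⟨b, hb⟩ := hg
  refine ⟨a * b, fun x => ?_⟩
  rw [abs_mul]
  exact mul_le_mul (ha x) (hb x) (abs_nonneg _) ((abs_nonneg _).trans (ha x))

theorem sum {ι : Type*} (s : Finset ι) {f : ι → α → ℝ} (hf : ∀ i, IsBdd (f i)) :
    IsBdd fun x => ∑ i ∈ s, f i x := by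
  choose b hb using hf
  exact ⟨∑ i ∈ s, b i, fun x =>
    (Finset.abs_sum_le_sum_abs _ _).trans (Finset.sum_le_sum fun i _ => hb i x)⟩

theorem comp {β : Type*} (hf : IsBdd f) (g : β → α) : IsBdd fun x => f (g x) := by
  obtain ⟨a, ha⟩ := hf
  exact ⟨a, fun x => ha _⟩

end IsBdd

/-! ### Real-valued expectations of bounded functions -/

section Exp

variable {α β : Type*}

theorem hasSum_toReal (p : PMF α) : HasSum (fun x => (p x).toReal) 1 := by
  have h := p.tsum_coe
  have h2 : Summable fun x => (p x).toReal := ENNReal.summable_toReal (h ▸ ENNReal.one_ne_top)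
  have h3 : ∑' x, (p x).toReal = 1 := by
    rw [← ENNReal.tsum_toReal_eq fun x => p.apply_ne_top x, h, ENNReal.toReal_one]
  exact h3 ▸ h2.hasSum

theorem summable_pmfExp (p : PMF α) {f : α → ℝ} (hf : IsBdd f) :
    Summable fun x => (p x).toReal * f x := by
  obtain ⟨b, hb⟩ := hf
  refine Summable.of_norm_bounded ((hasSum_toReal p).summable.mul_right b) fun x => ?_
  rw [Real.norm_eq_abs, abs_mul, abs_of_nonneg ENNReal.toReal_nonneg]
  exact mul_le_mul_of_nonneg_left (hb x) ENNReal.toReal_nonneg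

theorem pmfExp_const (p : PMF α) (c : ℝ) : (pmfExp p fun _ => c) = c := by
  unfold pmfExp
  rw [tsum_mul_right, (hasSum_toReal p).tsum_eq, one_mul]

theorem pmfExp_const_mul (p : PMF α) (c : ℝ) (f : α → ℝ) :
    (pmfExp p fun x => c * f x) = c * pmfExp p f := by
  unfold pmfExp
  rw [← tsum_mul_left]
  exact tsum_congr fun x => by ring

theorem pmfExp_add (p : PMF α) {f g : α → ℝ} (hf : IsBdd f) (hg : IsBdd g) :
    (pmfExp p fun x => f x + g x) = pmfExp p f + pmfExp p g := by
  unfold pmfExp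
  rw [← (summable_pmfExp p hf).tsum_add (summable_pmfExp p hg)]
  exact tsum_congr fun x => by ring

theorem pmfExp_sum {ι : Type*} (p : PMF α) (s : Finset ι) {f : ι → α → ℝ}
    (hf : ∀ i, IsBdd (f i)) : (pmfExp p fun x => ∑ i ∈ s, f i x) = ∑ i ∈ s, pmfExp p (f i) := by
  unfold pmfExp
  rw [← Summable.tsum_finsetSum fun i _ => summable_pmfExp p (hf i)]
  exact tsum_congr fun x => Finset.mul_sum _ _ _

theorem pmfExp_mono (p : PMF α) {f g : α → ℝ} (hf : IsBdd f) (hg : IsBdd g)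
    (h : ∀ x, f x ≤ g x) : pmfExp p f ≤ pmfExp p g :=
  (summable_pmfExp p hf).tsum_le_tsum
    (fun x => mul_le_mul_of_nonneg_left (h x) ENNReal.toReal_nonneg) (summable_pmfExp p hg)

theorem pmfExp_le_of_le (p : PMF α) {f : α → ℝ} (hf : IsBdd f) {c : ℝ} (h : ∀ x, f x ≤ c) :
    pmfExp p f ≤ c :=
  (pmfExp_mono p hf (IsBdd.const c) h).trans_eq (pmfExp_const p c)

theorem pmfExp_nonneg (p : PMF α) {f : α → ℝ} (h : ∀ x, 0 ≤ f x) : 0 ≤ pmfExp p f :=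
  tsum_nonneg fun x => mul_nonneg ENNReal.toReal_nonneg (h x)

theorem abs_pmfExp_le (p : PMF α) {f : α → ℝ} {b : ℝ} (h : ∀ x, |f x| ≤ b) :
    |pmfExp p f| ≤ b := by
  have hf := IsBdd.of_abs_le h
  refine abs_le.2 ⟨?_, pmfExp_le_of_le p hf fun x => (abs_le.1 (h x)).2⟩
  exact (pmfExp_const p (-b)).symm.trans_le
    (pmfExp_mono p (IsBdd.const _) hf fun x => (abs_le.1 (h x)).1)

theorem ofReal_pmfExp (p : PMF α) {f : α → ℝ} (hf : IsBdd f) (h : ∀ x, 0 ≤ f x) :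
    ENNReal.ofReal (pmfExp p f) = pmfLExp p fun x => ENNReal.ofReal (f x) := by
  unfold pmfExp pmfLExp
  rw [ENNReal.ofReal_tsum_of_nonneg
    (fun x => mul_nonneg ENNReal.toReal_nonneg (h x)) (summable_pmfExp p hf)]
  refine tsum_congr fun x => ?_
  rw [ENNReal.ofReal_mul ENNReal.toReal_nonneg, ENNReal.ofReal_toReal (p.apply_ne_top x)]

theorem IsBdd.pmfExp {f : β → ℝ} (hf : IsBdd f) (q : α → PMF β) :
    IsBdd fun x => pmfExp (q x) f := by
  obtain ⟨b, hb⟩ := hf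
  exact ⟨b, fun x => abs_pmfExp_le _ hb⟩

theorem pmfExp_bind (p : PMF α) (q : α → PMF β) {f : β → ℝ} (hf : IsBdd f) :
    pmfExp (p.bind q) f = pmfExp p fun x => pmfExp (q x) f := by
  -- Nonnegative functions are handled in `[0, ∞]`, where sums interchange freely; a bounded
  -- function is then shifted by its bound to become nonnegative.
  have key : ∀ g : β → ℝ, IsBdd g → (∀ y, 0 ≤ g y) →
      pmfExp (p.bind q) g = pmfExp p fun x => pmfExp (q x) g := by
    intro g hg h0
    refine (ENNReal.ofReal_eq_ofReal_iff (pmfExp_nonneg _ h0)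
      (pmfExp_nonneg _ fun x => pmfExp_nonneg _ h0)).1 ?_
    rw [ofReal_pmfExp _ hg h0, pmfLExp_bind,
      ofReal_pmfExp _ (hg.pmfExp q) fun x => pmfExp_nonneg _ h0]
    simp only [ofReal_pmfExp _ hg h0]
  obtain ⟨b, hb⟩ := id hf
  have h := key (fun y => f y + b) (hf.add (IsBdd.const b)) fun y => by
    linarith [(abs_le.1 (hb y)).1]
  simp only [pmfExp_add _ hf (IsBdd.const b), pmfExp_const] at h
  rw [pmfExp_add _ (hf.pmfExp q) (IsBdd.const b), pmfExp_const] at h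
  linarith

theorem pmfExp_pure (a : α) (f : α → ℝ) : pmfExp (PMF.pure a) f = f a := by
  classical
  unfold pmfExp
  rw [tsum_eq_single a]
  · simp
  · intro b hb
    simp [hb]

theorem pmfExp_map (p : PMF α) (g : α → β) {f : β → ℝ} (hf : IsBdd f) :
    pmfExp (p.map g) f = pmfExp p fun x => f (g x) := by
  rw [PMF.map, pmfExp_bind _ _ hf]
  simp [pmfExp_pure]

/-! ### Bernstein's inequality -/

theorem Real.exp_le_one_add_add_sq {x : ℝ} (hx : |x| ≤ 1) : Real.exp x ≤ 1 + x + x ^ 2 := by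
  have := abs_le.1 (Real.abs_exp_sub_one_sub_id_le hx)
  linarith [this.2]

/-- Where `|r h| ≤ 1`, the inequality eˣ ≤ 1 + x + x² bounds the exponential moment by 1 plus the
compensator, and 1 + m ≤ eᵐ finishes. The raw second moment serves in place of the variance. -/
theorem pmfLExp_exp_le (p : PMF α) {h : α → ℝ} {b v r : ℝ} (hb : ∀ x, |h x| ≤ b)
    (hv : (pmfExp p fun x => h x ^ 2) ≤ v) (hr : |r| * b ≤ 1) :
    (pmfLExp p fun x => ENNReal.ofReal (Real.exp (r * h x - (r * pmfExp p h + r ^ 2 * v)))) ≤ 1 := by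
  have hB := IsBdd.of_abs_le hb
  have hB2 : IsBdd fun x => h x ^ 2 := by simpa only [sq] using hB.mul hB
  have hle : ∀ x, |r * h x| ≤ 1 := fun x => by
    rw [abs_mul]
    exact (mul_le_mul_of_nonneg_left (hb x) (abs_nonneg r)).trans hr
  have hsum : IsBdd fun x => (1 + r * h x) + r ^ 2 * h x ^ 2 :=
    ((IsBdd.const 1).add ((IsBdd.const r).mul hB)).add ((IsBdd.const (r ^ 2)).mul hB2)
  set m := r * pmfExp p h + r ^ 2 * v
  have hpt : ∀ x, Real.exp (r * h x) ≤ (1 + r * h x) + r ^ 2 * h x ^ 2 := fun x => by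
    have := Real.exp_le_one_add_add_sq (hle x)
    rwa [mul_pow] at this
  have h1 : (pmfLExp p fun x => ENNReal.ofReal (Real.exp (r * h x))) ≤
      ENNReal.ofReal (Real.exp m) := by
    calc _ ≤ pmfLExp p fun x => ENNReal.ofReal ((1 + r * h x) + r ^ 2 * h x ^ 2) :=
          pmfLExp_mono p fun x => ENNReal.ofReal_le_ofReal (hpt x)
      _ = ENNReal.ofReal (pmfExp p fun x => (1 + r * h x) + r ^ 2 * h x ^ 2) :=
          (ofReal_pmfExp p hsum fun x => (Real.exp_pos _).le.trans (hpt x)).symm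
      _ ≤ _ := by
          refine ENNReal.ofReal_le_ofReal ?_
          rw [pmfExp_add _ ((IsBdd.const 1).add ((IsBdd.const r).mul hB))
            ((IsBdd.const (r ^ 2)).mul hB2),
            pmfExp_add _ (IsBdd.const 1) ((IsBdd.const r).mul hB), pmfExp_const, pmfExp_const_mul,
            pmfExp_const_mul]
          have := mul_le_mul_of_nonneg_left hv (sq_nonneg r)
          have := Real.add_one_le_exp m
          simp only [m] at *
          linarith
  have h2 : ∀ x, ENNReal.ofReal (Real.exp (r * h x - m)) =
      ENNReal.ofReal (Real.exp (-m)) * ENNReal.ofReal (Real.exp (r * h x)) := fun x => by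
    rw [← ENNReal.ofReal_mul (Real.exp_pos _).le, ← Real.exp_add]
    congr 2
    ring
  simp only [h2, pmfLExp_const_mul]
  refine (mul_le_mul_right h1 _).trans_eq ?_
  rw [← ENNReal.ofReal_mul (Real.exp_pos _).le, ← Real.exp_add]
  simp

/-- The choice of the exponent in Bernstein's inequality. -/
theorem exists_bernstein_rate {b t w : ℝ} (hb : 0 < b) (ht : 0 < t) (hw : 0 ≤ w) :
    ∃ r : ℝ, 0 < r ∧ r * b ≤ 1 ∧ r ^ 2 * w + t ≤ r * (2 * Real.sqrt (w * t) + b * t) := by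
  set q := Real.sqrt w
  set τ := Real.sqrt t
  have hτ : 0 < τ := Real.sqrt_pos.2 ht
  have hq : 0 ≤ q := Real.sqrt_nonneg _
  have hqw : q ^ 2 = w := Real.sq_sqrt hw
  have hτt : τ ^ 2 = t := Real.sq_sqrt ht.le
  have hs : Real.sqrt (w * t) = q * τ := Real.sqrt_mul hw t
  have hden : 0 < b * τ + q := by positivity
  refine ⟨τ / (b * τ + q), by positivity, ?_, ?_⟩
  · rw [div_mul_eq_mul_div, div_le_one hden]
    nlinarith
  · rw [hs, ← hqw, ← hτt]
    rw [div_pow, div_mul_eq_mul_div, div_mul_eq_mul_div, ← sub_nonneg]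
    have : τ * (2 * (q * τ) + b * τ ^ 2) / (b * τ + q) -
        (τ ^ 2 * q ^ 2 / (b * τ + q) ^ 2 + τ ^ 2) = τ ^ 3 * b * q / (b * τ + q) ^ 2 := by
      field_simp
      ring
    rw [this]
    positivity

/-- Bernstein's inequality for the sum of a process whose exponential compensator is controlled. -/
theorem bernstein_tail (p : PMF α) (X : α → ℝ) {b t w : ℝ} (hb : 0 < b) (ht : 0 < t) (hw : 0 ≤ w)
    (h : ∀ r : ℝ, |r| * b ≤ 1 →
      (pmfLExp p fun x => ENNReal.ofReal (Real.exp (r * X x - r ^ 2 * w))) ≤ 1) :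
    p.toOuterMeasure {x | 2 * Real.sqrt (w * t) + b * t < |X x|} ≤
      2 * ENNReal.ofReal (Real.exp (-t)) := by
  obtain ⟨r, hr, hrb, hrt⟩ := exists_bernstein_rate hb ht hw
  have key : ∀ s : ℝ, |s| = r →
      p.toOuterMeasure {x | r * (2 * Real.sqrt (w * t) + b * t) < s * X x} ≤
        ENNReal.ofReal (Real.exp (-t)) := by
    intro s hs
    have hs2 : s ^ 2 = r ^ 2 := by rw [← sq_abs, hs]
    calc _ ≤ pmfLExp p fun x => ENNReal.ofReal (Real.exp (-t)) *
          ENNReal.ofReal (Real.exp (s * X x - s ^ 2 * w)) := by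
          refine toOuterMeasure_le_pmfLExp p fun x hx => ?_
          rw [← ENNReal.ofReal_mul (Real.exp_pos _).le, ← Real.exp_add, ← ENNReal.ofReal_one]
          refine ENNReal.ofReal_le_ofReal (Real.one_le_exp ?_)
          rw [hs2]
          rw [Set.mem_ofPred_eq] at hx
          linarith
      _ ≤ _ := by
          rw [pmfLExp_const_mul]
          exact mul_le_of_le_one_right' (h s (hs ▸ hrb))
  have hsub : {x | 2 * Real.sqrt (w * t) + b * t < |X x|} ⊆
      {x | r * (2 * Real.sqrt (w * t) + b * t) < r * X x} ∪
      {x | r * (2 * Real.sqrt (w * t) + b * t) < -r * X x} := by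
    intro x hx
    rcases lt_abs.1 (show _ < |X x| from hx) with h1 | h1
    · exact Or.inl (mul_lt_mul_of_pos_left h1 hr)
    · refine Or.inr ?_
      have := mul_lt_mul_of_pos_left h1 hr
      simpa using this
  refine (MeasureTheory.measure_mono hsub).trans ((MeasureTheory.measure_union_le _ _).trans ?_)
  rw [two_mul (ENNReal.ofReal _)]
  exact add_le_add (key r (abs_of_pos hr)) (key (-r) (by rw [abs_neg, abs_of_pos hr]))

/-- Bernstein's inequality for independent samples. -/
theorem bernstein_iid {α : Type u} {K : ℕ} (p : PMF α) {h : α → ℝ} {b v t : ℝ} (hb : 0 < b)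
    (ht : 0 < t) (hbd : ∀ x, |h x| ≤ b) (hv : (pmfExp p fun x => h x ^ 2) ≤ v) :
    (pmfPi fun _ : Fin K => p).toOuterMeasure
      {x | 2 * Real.sqrt (K * v * t) + b * t < |∑ κ, h (x κ) - K * pmfExp p h|} ≤
      2 * ENNReal.ofReal (Real.exp (-t)) := by
  have hv0 : 0 ≤ v := (pmfExp_nonneg p fun x => sq_nonneg _).trans hv
  refine bernstein_tail _ (fun x : Fin K → α => ∑ κ, h (x κ) - K * pmfExp p h) hb ht
    (by positivity) fun r hr => ?_
  have : ∀ x : Fin K → α,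
      ENNReal.ofReal (Real.exp (r * (∑ κ, h (x κ) - K * pmfExp p h) - r ^ 2 * (K * v))) =
      ∏ κ, ENNReal.ofReal (Real.exp (r * h (x κ) - (r * pmfExp p h + r ^ 2 * v))) := by
    intro x
    rw [← ENNReal.ofReal_prod_of_nonneg fun _ _ => (Real.exp_pos _).le, ← Real.exp_sum]
    congr 2
    rw [Finset.sum_sub_distrib, ← Finset.mul_sum]
    simp
    ring
  simp only [this]
  rw [pmfLExp_pmfPi_prod (fun _ : Fin K => p)
    fun _ y => ENNReal.ofReal (Real.exp (r * h y - (r * pmfExp p h + r ^ 2 * v)))]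
  exact Finset.prod_le_one' fun κ _ => pmfLExp_exp_le p hbd hv hr

end Exp

/-! ### Quadratic forms -/

section LinearAlgebra

variable {d : ℕ}

theorem dotProduct_sq_le (x y : Fin d → ℝ) : (x ⬝ᵥ y) ^ 2 ≤ (x ⬝ᵥ x) * (y ⬝ᵥ y) := by
  have := Finset.sum_mul_sq_le_sq_mul_sq Finset.univ x y
  simpa only [dotProduct, sq] using this

theorem dotProduct_self_nonneg' (x : Fin d → ℝ) : 0 ≤ x ⬝ᵥ x :=
  Finset.sum_nonneg fun j _ => mul_self_nonneg (x j)

theorem norm_toLp_sq (x : Fin d → ℝ) : ‖WithLp.toLp 2 x‖ ^ 2 = x ⬝ᵥ x := by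
  rw [EuclideanSpace.norm_sq_eq]
  simp [dotProduct, sq]

theorem sum_smul_dotProduct (z : Fin d → ℝ) (n : Fin d → Fin d → ℝ) (f : Fin d → ℝ) :
    (∑ j, z j • n j) ⬝ᵥ f = z ⬝ᵥ fun j => n j ⬝ᵥ f := by
  rw [sum_dotProduct]
  simp [dotProduct, Finset.mul_sum, mul_assoc]

open scoped MatrixOrder Matrix.Norms.L2Operator in
/-- A positive definite form has a basis in which it is the standard one. -/
theorem exists_whitening {W : Matrix (Fin d) (Fin d) ℝ} (hW : W.PosDef) :
    ∃ n : Fin d → Fin d → ℝ,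
      (∀ z : Fin d → ℝ, (∑ j, z j • n j) ⬝ᵥ (W *ᵥ ∑ j, z j • n j) = z ⬝ᵥ z) ∧
      ∀ x, ∃ z : Fin d → ℝ, x = ∑ j, z j • n j := by
  -- Factor W = BᵀB; the columns of B⁻¹ form the basis, and Bx gives the coordinates of x.
  obtain ⟨B, hB⟩ := CStarAlgebra.nonneg_iff_eq_star_mul_self.1 hW.posSemidef.nonneg
  rw [Matrix.star_eq_conjTranspose, Matrix.conjTranspose_eq_transpose_of_trivial] at hB
  have hdet : IsUnit B.det := by
    have h := hW.det_pos
    rw [hB, Matrix.det_mul] at h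
    exact isUnit_iff_ne_zero.2 fun h0 => by simp [h0] at h
  have hsum : ∀ z : Fin d → ℝ, ∑ j, z j • (fun i => B⁻¹ i j) = B⁻¹ *ᵥ z := by
    intro z
    ext i
    simp [Matrix.mulVec, dotProduct, mul_comm]
  refine ⟨fun j i => B⁻¹ i j, fun z => ?_, fun x => ⟨B *ᵥ x, ?_⟩⟩
  · rw [hsum, hB, ← Matrix.mulVec_mulVec, Matrix.dotProduct_mulVec, Matrix.vecMul_transpose,
      Matrix.mulVec_mulVec, Matrix.mul_nonsing_inv _ hdet, Matrix.one_mulVec]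
  · rw [hsum, Matrix.mulVec_mulVec, Matrix.nonsing_inv_mul _ hdet, Matrix.one_mulVec]

theorem abs_dotProduct_le_of_dotProduct_self_le {x y : Fin d → ℝ} {a b : ℝ} (ha : x ⬝ᵥ x ≤ a)
    (hb : y ⬝ᵥ y ≤ b) : |x ⬝ᵥ y| ≤ Real.sqrt (a * b) :=
  Real.abs_le_sqrt ((dotProduct_sq_le x y).trans
    (mul_le_mul ha hb (dotProduct_self_nonneg' y) ((dotProduct_self_nonneg' x).trans ha)))

end LinearAlgebra

/-! ### Second moments -/

section Covariance

variable {Z : Type u} {d K : ℕ}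

/-- The bilinear form `(y, w) ↦ E[(yᵀ f)(fᵀ w)]`. -/
def momentForm (p : PMF Z) (f : Z → Fin d → ℝ) (y w : Fin d → ℝ) : ℝ :=
  pmfExp p fun z => (y ⬝ᵥ f z) * (f z ⬝ᵥ w)

/-- The bilinear form of the empirical second moment matrix. -/
def sampleForm (x : Fin K → Z) (f : Z → Fin d → ℝ) (y w : Fin d → ℝ) : ℝ :=
  1 / (K : ℝ) * ∑ κ, (y ⬝ᵥ f (x κ)) * (f (x κ) ⬝ᵥ w)

/-- The second moment matrix. -/
def momentMatrix (p : PMF Z) (f : Z → Fin d → ℝ) : Matrix (Fin d) (Fin d) ℝ :=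
  Matrix.of fun j l => pmfExp p fun z => f z j * f z l

/-- Boundedness of a vector-valued function. -/
def IsBddVec (f : Z → Fin d → ℝ) : Prop := ∃ b, ∀ z, f z ⬝ᵥ f z ≤ b

theorem IsBddVec.dotProduct {f : Z → Fin d → ℝ} (hf : IsBddVec f) (y : Fin d → ℝ) :
    IsBdd fun z => y ⬝ᵥ f z := by
  obtain ⟨b, hb⟩ := hf
  exact ⟨_, fun z => abs_dotProduct_le_of_dotProduct_self_le le_rfl (hb z)⟩

theorem IsBddVec.dotProduct' {f : Z → Fin d → ℝ} (hf : IsBddVec f) (y : Fin d → ℝ) :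
    IsBdd fun z => f z ⬝ᵥ y := by
  simpa only [dotProduct_comm] using hf.dotProduct y

theorem IsBddVec.apply {f : Z → Fin d → ℝ} (hf : IsBddVec f) (j : Fin d) :
    IsBdd fun z => f z j := by
  simpa using hf.dotProduct (Pi.single j 1)

theorem momentMatrix_form (p : PMF Z) {f : Z → Fin d → ℝ} (hf : IsBddVec f) (y w : Fin d → ℝ) :
    y ⬝ᵥ (momentMatrix p f *ᵥ w) = momentForm p f y w := by
  have h2 : ∀ j l, IsBdd fun z => f z j * f z l := fun j l => (hf.apply j).mul (hf.apply l)
  have : (fun z => (y ⬝ᵥ f z) * (f z ⬝ᵥ w)) =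
      fun z => ∑ j, ∑ l, (y j * w l) * (f z j * f z l) := by
    ext z
    simp only [_root_.dotProduct, Finset.sum_mul_sum]
    exact Finset.sum_congr rfl fun j _ => Finset.sum_congr rfl fun l _ => by ring
  rw [momentForm, this, pmfExp_sum _ _ fun j => IsBdd.sum _ fun l => (IsBdd.const _).mul (h2 j l)]
  simp only [pmfExp_sum _ _ fun l => (IsBdd.const _).mul (h2 _ l), pmfExp_const_mul,
    _root_.dotProduct, Matrix.mulVec, momentMatrix, Matrix.of_apply, Finset.mul_sum]
  exact Finset.sum_congr rfl fun j _ => Finset.sum_congr rfl fun l _ => by ring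

theorem momentForm_self_nonneg (p : PMF Z) (f : Z → Fin d → ℝ) (y : Fin d → ℝ) :
    0 ≤ momentForm p f y y :=
  pmfExp_nonneg p fun z => by
    rw [dotProduct_comm (f z)]
    exact mul_self_nonneg _

theorem sampleForm_self_nonneg (x : Fin K → Z) (f : Z → Fin d → ℝ) (y : Fin d → ℝ) :
    0 ≤ sampleForm x f y y :=
  mul_nonneg (by positivity) (Finset.sum_nonneg fun κ _ => by
    rw [dotProduct_comm (f (x κ))]
    exact mul_self_nonneg _)

theorem Matrix.posDef_of_form {W : Matrix (Fin d) (Fin d) ℝ} {c : ℝ} (hc : 0 < c)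
    (hs : W.IsHermitian) (h : ∀ y, c * (y ⬝ᵥ y) ≤ y ⬝ᵥ (W *ᵥ y)) : W.PosDef := by
  refine Matrix.PosDef.of_dotProduct_mulVec_pos hs fun y hy => ?_
  rw [star_trivial]
  refine lt_of_lt_of_le (mul_pos hc ?_) (h y)
  exact lt_of_le_of_ne (dotProduct_self_nonneg' y) fun h0 => hy (dotProduct_self_eq_zero.1 h0.symm)

theorem posDef_momentMatrix_add (p : PMF Z) {f : Z → Fin d → ℝ} (hf : IsBddVec f) {c : ℝ}
    (hc : 0 < c) : (momentMatrix p f + c • (1 : Matrix (Fin d) (Fin d) ℝ)).PosDef := by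
  refine Matrix.posDef_of_form hc ?_ fun y => ?_
  · ext j l
    simp [momentMatrix, Matrix.one_apply, mul_comm, eq_comm]
  · rw [Matrix.add_mulVec, dotProduct_add, momentMatrix_form p hf, Matrix.smul_mulVec,
      Matrix.one_mulVec, dotProduct_smul, smul_eq_mul]
    linarith [momentForm_self_nonneg p f y]

theorem sq_apply_le_dotProduct_self (g : Fin d → ℝ) (j : Fin d) : g j ^ 2 ≤ g ⬝ᵥ g := by
  rw [sq]
  exact Finset.single_le_sum (f := fun j => g j * g j) (fun j _ => mul_self_nonneg _)
    (Finset.mem_univ j)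

theorem dotProduct_mul_dotProduct (y w u v : Fin d → ℝ) :
    (y ⬝ᵥ u) * (w ⬝ᵥ v) = ∑ q : Fin d × Fin d, (y q.1 * w q.2) * (u q.1 * v q.2) := by
  rw [dotProduct, dotProduct, Finset.sum_mul_sum, Fintype.sum_prod_type]
  exact Finset.sum_congr rfl fun j _ => Finset.sum_congr rfl fun l _ => by ring

theorem sum_sq_mul_sq (y w : Fin d → ℝ) :
    ∑ q : Fin d × Fin d, (y q.1 * w q.2) ^ 2 = (y ⬝ᵥ y) * (w ⬝ᵥ w) := by
  rw [dotProduct_mul_dotProduct]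
  exact Finset.sum_congr rfl fun q _ => by ring

theorem IsBdd.pow_two {g : Z → ℝ} (hg : IsBdd g) : IsBdd fun z => g z ^ 2 := by
  simpa only [sq] using hg.mul hg

/-- The entry `E[aⱼ bₗ]` minus its empirical counterpart. -/
def entryGap (p : PMF Z) (a b : Z → Fin d → ℝ) (x : Fin K → Z) (q : Fin d × Fin d) : ℝ :=
  (pmfExp p fun z => a z q.1 * b z q.2) - 1 / (K : ℝ) * ∑ κ, a (x κ) q.1 * b (x κ) q.2

/-- The error of the bilinear form is the pairing of y ⊗ w with the matrix of entry errors, so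
Cauchy-Schwarz will bound it by the Frobenius norm of that matrix. -/
theorem entryGap_bilinear (p : PMF Z) {a b : Z → Fin d → ℝ} (ha : IsBddVec a) (hb : IsBddVec b)
    (x : Fin K → Z) (y w : Fin d → ℝ) :
    (pmfExp p fun z => (y ⬝ᵥ a z) * (w ⬝ᵥ b z)) -
      1 / (K : ℝ) * ∑ κ, (y ⬝ᵥ a (x κ)) * (w ⬝ᵥ b (x κ)) =
      ∑ q : Fin d × Fin d, (y q.1 * w q.2) * entryGap p a b x q := by
  have habd : ∀ q : Fin d × Fin d, IsBdd fun z => a z q.1 * b z q.2 :=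
    fun q => (ha.apply q.1).mul (hb.apply q.2)
  simp only [dotProduct_mul_dotProduct]
  rw [pmfExp_sum _ _ fun q => (IsBdd.const _).mul (habd q)]
  simp only [pmfExp_const_mul]
  rw [Finset.sum_comm, Finset.mul_sum, ← Finset.sum_sub_distrib]
  refine Finset.sum_congr rfl fun q _ => ?_
  rw [entryGap, ← Finset.mul_sum]
  ring

/-- The second moments of all entries sum to E[|a|²|b|²]. Bounding |b|² pointwise and |a|² only on
average costs one factor d instead of the d² of an entrywise bound. -/
theorem sum_pmfExp_sq_le (p : PMF Z) {a b : Z → Fin d → ℝ} {α β : ℝ} (hβ : 0 ≤ β)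
    (ha : ∀ z, a z ⬝ᵥ a z ≤ α) (hb : ∀ z, b z ⬝ᵥ b z ≤ β)
    (hE : (pmfExp p fun z => a z ⬝ᵥ a z) ≤ d) :
    (∑ q : Fin d × Fin d, pmfExp p fun z => (a z q.1 * b z q.2) ^ 2) ≤ β * d := by
  have hav : IsBddVec a := ⟨α, ha⟩
  have hbv : IsBddVec b := ⟨β, hb⟩
  have hq : ∀ q : Fin d × Fin d, IsBdd fun z => (a z q.1 * b z q.2) ^ 2 :=
    fun q => ((hav.apply q.1).mul (hbv.apply q.2)).pow_two
  rw [← pmfExp_sum _ _ hq]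
  have haa : IsBdd fun z => a z ⬝ᵥ a z :=
    IsBdd.of_abs_le (b := α) fun z => by
      rw [abs_of_nonneg (dotProduct_self_nonneg' _)]; exact ha z
  refine (pmfExp_mono p (IsBdd.sum _ hq) ((IsBdd.const β).mul haa)
    fun z => ?_).trans ((pmfExp_const_mul p β _).trans_le (mul_le_mul_of_nonneg_left hE hβ))
  rw [sum_sq_mul_sq, mul_comm]
  exact mul_le_mul_of_nonneg_right (hb z) (dotProduct_self_nonneg' _)

/-- (u + v)² ≤ 2u² + 2v² splits the squared Bernstein radius into a multiple of the variance and a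
constant, so that summing over entries involves only the total variance. -/
theorem entryGap_sq_le {p : PMF Z} {a b : Z → Fin d → ℝ} {x : Fin K → Z} {q : Fin d × Fin d}
    {v c t : ℝ} (hK : 0 < K) (hv : 0 ≤ v) (hc : 0 ≤ c) (ht : 0 ≤ t)
    (h : |∑ κ, a (x κ) q.1 * b (x κ) q.2 - K * pmfExp p fun z => a z q.1 * b z q.2| ≤
      2 * Real.sqrt (K * v * t) + Real.sqrt c * t) :
    entryGap p a b x q ^ 2 ≤ 8 * t / K * v + 2 * t ^ 2 * c / K ^ 2 := by
  have hK' : (0 : ℝ) < K := Nat.cast_pos.2 hK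
  have h2 : |∑ κ, a (x κ) q.1 * b (x κ) q.2 - K * pmfExp p fun z => a z q.1 * b z q.2| =
      K * |entryGap p a b x q| := by
    rw [show (K : ℝ) * |entryGap p a b x q| = |K * entryGap p a b x q| by
      rw [abs_mul, abs_of_pos hK'], ← abs_neg, entryGap]
    congr 1
    field_simp
    ring
  rw [h2] at h
  have h3 := pow_le_pow_left₀ (by positivity) h 2
  have e1 := Real.sq_sqrt (mul_nonneg (mul_nonneg hK'.le hv) ht)
  have e2 := Real.sq_sqrt hc
  have e3 := sq_nonneg (2 * Real.sqrt (K * v * t) - Real.sqrt c * t)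
  have e4 : (Real.sqrt c * t) ^ 2 = t ^ 2 * c := by rw [mul_pow, e2]; ring
  rw [mul_pow, sq_abs] at h3
  have h5 : 8 * t / K * v + 2 * t ^ 2 * c / K ^ 2 =
      (8 * (K * v * t) + 2 * t ^ 2 * c) / K ^ 2 := by
    field_simp
  rw [h5, le_div_iff₀ (by positivity)]
  nlinarith

/-- Concentration of the empirical second moments of two vector-valued functions. -/
theorem frobenius_concentration (p : PMF Z) {a b : Z → Fin d → ℝ} {α β t : ℝ} (hα : 0 < α)
    (hβ : 0 < β) (ht : 0 < t) (hK : 0 < K) (ha : ∀ z, a z ⬝ᵥ a z ≤ α) (hb : ∀ z, b z ⬝ᵥ b z ≤ β)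
    (hE : (pmfExp p fun z => a z ⬝ᵥ a z) ≤ d) :
    (pmfPi fun _ : Fin K => p).toOuterMeasure
      {x | ¬ ∀ y w : Fin d → ℝ,
        ((pmfExp p fun z => (y ⬝ᵥ a z) * (w ⬝ᵥ b z)) -
          1 / (K : ℝ) * ∑ κ, (y ⬝ᵥ a (x κ)) * (w ⬝ᵥ b (x κ))) ^ 2 ≤
        (y ⬝ᵥ y) * (w ⬝ᵥ w) * (8 * t * (β * d) / K + 2 * d ^ 2 * t ^ 2 * (α * β) / K ^ 2)} ≤
      2 * d ^ 2 * ENNReal.ofReal (Real.exp (-t)) := by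
  have hbd : ∀ q : Fin d × Fin d, ∀ z, |a z q.1 * b z q.2| ≤ Real.sqrt (α * β) := fun q z => by
    refine Real.abs_le_sqrt ?_
    rw [mul_pow]
    exact mul_le_mul ((sq_apply_le_dotProduct_self _ _).trans (ha z))
      ((sq_apply_le_dotProduct_self _ _).trans (hb z)) (sq_nonneg _) hα.le
  -- Each of the d² entries keeps its exact second moment as variance proxy (`le_rfl`); only their
  -- sum is estimated.
  have hunion := toOuterMeasure_iUnion_le (pmfPi fun _ : Fin K => p) _ fun q : Fin d × Fin d =>
    bernstein_iid (K := K) p (Real.sqrt_pos.2 (mul_pos hα hβ)) ht (hbd q) le_rfl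
  refine (MeasureTheory.measure_mono ?_).trans (hunion.trans_eq ?_)
  swap
  · rw [Fintype.card_prod, Fintype.card_fin, Nat.cast_mul]
    ring
  intro x hx
  by_contra hx2
  refine hx fun y w => ?_
  rw [Set.mem_iUnion, not_exists] at hx2
  rw [entryGap_bilinear p ⟨α, ha⟩ ⟨β, hb⟩]
  refine (Finset.sum_mul_sq_le_sq_mul_sq _ _ _).trans ?_
  rw [sum_sq_mul_sq]
  refine mul_le_mul_of_nonneg_left ?_
    (mul_nonneg (dotProduct_self_nonneg' _) (dotProduct_self_nonneg' _))
  refine (Finset.sum_le_sum fun q _ => entryGap_sq_le hK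
    (pmfExp_nonneg p fun z => sq_nonneg _) (mul_pos hα hβ).le ht.le (not_lt.1 (hx2 q))).trans ?_
  rw [Finset.sum_add_distrib, ← Finset.mul_sum]
  have := mul_le_mul_of_nonneg_left (sum_pmfExp_sq_le p hβ.le ha hb hE)
    (show 0 ≤ 8 * t / K by positivity)
  rw [Finset.sum_const, Finset.card_univ, Fintype.card_prod, Fintype.card_fin, nsmul_eq_mul,
    Nat.cast_mul]
  refine add_le_add (this.trans_eq ?_) (le_of_eq ?_) <;> ring

/-- Concentration of the empirical second moment matrix, relative to the regularised one. -/
theorem sampleForm_concentration (p : PMF Z) {f : Z → Fin d → ℝ} {t : ℝ} (ht : 0 < t) (hK : 0 < K)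
    (hd : 0 < d) (hf : ∀ z, f z ⬝ᵥ f z ≤ 1) :
    (pmfPi fun _ : Fin K => p).toOuterMeasure
      {x | ¬ ((∀ y, momentForm p f y y ≤ 2 * sampleForm x f y y + 33 * d * t / K * (y ⬝ᵥ y)) ∧
        ∀ y θ, (momentForm p f y θ - sampleForm x f y θ) ^ 2 ≤
          9 * d * t / K * (θ ⬝ᵥ θ) * (momentForm p f y y + 33 * d * t / K * (y ⬝ᵥ y)))} ≤
      4 * d ^ 2 * ENNReal.ofReal (Real.exp (-t)) := by
  have hK' : (0 : ℝ) < K := Nat.cast_pos.2 hK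
  have hd' : (0 : ℝ) < d := Nat.cast_pos.2 hd
  have hfv : IsBddVec f := ⟨1, hf⟩
  -- 33 makes the relative Frobenius error 8/33 + 2/33² at most (1/2)².
  set g : ℝ := 33 * d * t / K with hg
  have hg0 : 0 < g := by positivity
  obtain ⟨n, hn, hspan⟩ := exists_whitening (posDef_momentMatrix_add p hfv hg0)
  have hform : ∀ y, y ⬝ᵥ ((momentMatrix p f + g • (1 : Matrix (Fin d) (Fin d) ℝ)) *ᵥ y) =
      momentForm p f y y + g * (y ⬝ᵥ y) := fun y => by
    rw [Matrix.add_mulVec, dotProduct_add, momentMatrix_form p hfv, Matrix.smul_mulVec,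
      Matrix.one_mulVec, dotProduct_smul, smul_eq_mul]
  simp only [hform] at hn
  set a : Z → Fin d → ℝ := fun z j => n j ⬝ᵥ f z with ha_def
  -- Here |a z|² is fᵀ(Σ + gI)⁻¹f. For the vector y with coordinates a z, yᵀf = |a z|² and g|y|² ≤
  -- |a z|², while Cauchy-Schwarz gives |a z|⁴ ≤ |y|².
  have ha : ∀ z, a z ⬝ᵥ a z ≤ 1 / g := fun z => by
    have h1 := hn (a z)
    set y := ∑ j, a z j • n j with hy
    have h2 : y ⬝ᵥ f z = a z ⬝ᵥ a z := sum_smul_dotProduct _ _ _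
    have h3 := dotProduct_sq_le y (f z)
    rw [h2] at h3
    have h4 := momentForm_self_nonneg p f y
    have h5 := dotProduct_self_nonneg' (a z)
    have h6 := dotProduct_self_nonneg' y
    rw [le_div_iff₀ hg0]
    by_contra h7
    rw [not_le] at h7
    have h8 : (a z ⬝ᵥ a z) ^ 2 ≤ y ⬝ᵥ y := h3.trans (mul_le_of_le_one_right h6 (hf z))
    have h9 : (a z ⬝ᵥ a z) ^ 2 * g ≤ a z ⬝ᵥ a z := by nlinarith
    have h10 : 0 < a z ⬝ᵥ a z := by
      by_contra h
      have : a z ⬝ᵥ a z = 0 := le_antisymm (not_lt.1 h) h5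
      rw [this] at h7
      linarith
    nlinarith
  -- Each basis vector has (Σ + gI)-norm one, so each of the d coordinates of a has second moment at
  -- most one.
  have hEa : (pmfExp p fun z => a z ⬝ᵥ a z) ≤ d := by
    have hb : ∀ j, IsBdd fun z => a z j * a z j := fun j =>
      (hfv.dotProduct (n j)).mul (hfv.dotProduct (n j))
    have : (pmfExp p fun z => a z ⬝ᵥ a z) = ∑ j, pmfExp p fun z => a z j * a z j :=
      pmfExp_sum p _ hb
    rw [this]
    refine (Finset.sum_le_sum (g := fun _ => (1 : ℝ)) fun j _ => ?_).trans (by simp)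
    have h1 := hn (Pi.single j 1)
    have h2 : ∑ l, (Pi.single j 1 : Fin d → ℝ) l • n l = n j := by
      simp [Pi.single_apply]
    rw [h2] at h1
    have h3 : (Pi.single j 1 : Fin d → ℝ) ⬝ᵥ Pi.single j 1 = 1 := by simp
    rw [h3] at h1
    have h4 : (pmfExp p fun z => a z j * a z j) = momentForm p f (n j) (n j) := by
      unfold momentForm
      simp only [dotProduct_comm (f _) (n j)]
      rfl
    rw [h4]
    have := mul_nonneg hg0.le (dotProduct_self_nonneg' (n j))
    linarith
  -- Whitening both arguments gives the relative comparison of Σ with Σ̂. In `c2` only the left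
  -- argument is whitened, so that θ is measured in its Euclidean norm.
  have c1 := frobenius_concentration p (one_div_pos.2 hg0) (one_div_pos.2 hg0) ht hK ha ha hEa
  have c2 := frobenius_concentration p (one_div_pos.2 hg0) one_pos ht hK ha hf hEa
  refine le_trans (MeasureTheory.measure_mono ?_)
    ((MeasureTheory.measure_union_le _ _).trans ((add_le_add c1 c2).trans_eq ?_))
  swap
  · ring
  intro x hx
  by_contra hx2
  rw [Set.mem_union, not_or, Set.notMem_ofPred_iff, Set.notMem_ofPred_iff, not_not, not_not] at hx2
  obtain ⟨x1, x2⟩ := hx2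
  refine hx ⟨fun y => ?_, fun y θ => ?_⟩
  · obtain ⟨z, rfl⟩ := hspan y
    have h1 := x1 z z
    have h2 := hn z
    set y := ∑ j, z j • n j with hy
    have e : ∀ w, z ⬝ᵥ a w = y ⬝ᵥ f w := fun w => (sum_smul_dotProduct _ _ _).symm
    simp only [e] at h1
    have h3 : (pmfExp p fun w => (y ⬝ᵥ f w) * (y ⬝ᵥ f w)) = momentForm p f y y := by
      unfold momentForm
      simp only [dotProduct_comm (f _) y]
    have h4 : 1 / (K : ℝ) * ∑ κ, (y ⬝ᵥ f (x κ)) * (y ⬝ᵥ f (x κ)) = sampleForm x f y y := by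
      unfold sampleForm
      simp only [dotProduct_comm (f _) y]
    rw [h3, h4] at h1
    have h5 : 8 * t * (1 / g * d) / K + 2 * d ^ 2 * t ^ 2 * (1 / g * (1 / g)) / K ^ 2 ≤
        (1 / 2) ^ 2 := by
      have : 8 * t * (1 / g * d) / K + 2 * d ^ 2 * t ^ 2 * (1 / g * (1 / g)) / K ^ 2 =
          8 / 33 + 2 / 33 ^ 2 := by
        rw [hg]
        field_simp
      rw [this]
      norm_num
    have h0 := dotProduct_self_nonneg' z
    have h6 : (momentForm p f y y - sampleForm x f y y) ^ 2 ≤ ((z ⬝ᵥ z) * (1 / 2)) ^ 2 := by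
      refine h1.trans ((mul_le_mul_of_nonneg_left h5 (mul_nonneg h0 h0)).trans_eq ?_)
      ring
    have h7 := (abs_le_of_sq_le_sq' h6 (by positivity)).2
    linarith
  · obtain ⟨z, rfl⟩ := hspan y
    have h1 := x2 z θ
    have h2 := hn z
    set y := ∑ j, z j • n j with hy
    have e : ∀ w, z ⬝ᵥ a w = y ⬝ᵥ f w := fun w => (sum_smul_dotProduct _ _ _).symm
    simp only [e, dotProduct_comm θ] at h1
    refine h1.trans ?_
    rw [h2]
    have h5 : 8 * t * (1 * d) / K + 2 * d ^ 2 * t ^ 2 * (1 / g * 1) / K ^ 2 ≤ 9 * d * t / K := by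
      have : 8 * t * (1 * d) / K + 2 * d ^ 2 * t ^ 2 * (1 / g * 1) / K ^ 2 =
          (8 + 2 / 33) * (d * t / K) := by
        rw [hg]
        field_simp
      rw [this]
      have : 9 * d * t / K = 9 * (d * t / K) := by ring
      rw [this]
      exact mul_le_mul_of_nonneg_right (by norm_num) (by positivity)
    have h0 := mul_nonneg (dotProduct_self_nonneg' z) (dotProduct_self_nonneg' θ)
    calc _ ≤ (z ⬝ᵥ z) * (θ ⬝ᵥ θ) * (9 * d * t / K) := mul_le_mul_of_nonneg_left h5 h0
      _ = _ := by ring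

end Covariance

/-! ### The learning rounds -/

namespace CCECall

variable {m d H : ℕ} {S : Fin (H + 1) → Type u} {A : Fin m → Type v}

/-- The standing boundedness assumptions. -/
structure IsBounded (Γ : CCECall m d H S A) : Prop where
  feat_le : ∀ i s a, Γ.feat i s a ⬝ᵥ Γ.feat i s a ≤ 1
  vbar_mem : ∀ i y, 0 ≤ Γ.Vbar i y ∧ Γ.Vbar i y ≤ (H : ℝ) - ((Γ.h : ℕ) + 1)

/-- Law of the roll-in state and joint action in the current layer. -/
def rollLaw (Γ : CCECall m d H S A) : PMF (Γ.X × (∀ j, A j)) := Γ.game.mixLaw Γ.mix Γ.h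

/-- The feature of agent `i` at a roll-in sample. -/
def rollFeat (Γ : CCECall m d H S A) (i : Fin m) (z : Γ.X × (∀ j, A j)) : Fin d → ℝ :=
  Γ.feat i z.1 (z.2 i)

/-- The return recorded in one episode. -/
def ret (Γ : CCECall m d H S A) (i : Fin m) (o : Obs Γ.X (S Γ.h.succ) (A i)) : ℝ :=
  o.loss + Γ.Vbar i o.next

/-- The scalar estimate `(yᵀ φ(s, a)) (ℓ + V̄(s'))`, from one record of agent `i`. -/
def score (Γ : CCECall m d H S A) (i : Fin m) (y : Fin d → ℝ)
    (o : Obs Γ.X (S Γ.h.succ) (A i)) : ℝ :=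
  (y ⬝ᵥ Γ.feat i o.state o.action) * Γ.ret i o

/-- Roll-in sample, joint action actually played, and next state, in one episode. -/
abbrev Episode (Γ : CCECall m d H S A) : Type (max u v) :=
  (Γ.X × (∀ j, A j)) × (∀ j, A j) × S Γ.h.succ

/-- Law of an episode in which the agents other than `i` follow `ρ` in the current layer. -/
def episodeLaw (Γ : CCECall m d H S A) (ρ : LayerPolicy Γ.X A) (i : Fin m) : PMF Γ.Episode :=
  Γ.rollLaw.bind fun z => (deviate ρ i z.1 (z.2 i)).bind fun a =>
    (Γ.game.P Γ.h z.1 a).map fun y => (z, a, y)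

/-- What agent `i` records of an episode. -/
def record (Γ : CCECall m d H S A) (i : Fin m) (e : Γ.Episode) : Obs Γ.X (S Γ.h.succ) (A i) :=
  ⟨e.1.1, e.1.2 i, Γ.game.loss i Γ.h e.1.1 e.2.1, e.2.2⟩

theorem obsLaw_eq_map (Γ : CCECall m d H S A) (ρ : LayerPolicy Γ.X A) (i : Fin m) :
    Γ.obsLaw ρ i = (Γ.episodeLaw ρ i).map (Γ.record i) := by
  simp only [obsLaw, episodeLaw, PMF.map_bind, PMF.map_comp]
  rfl

/-- The expectation of the score in an episode against `ρ`. -/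
def scoreMean (Γ : CCECall m d H S A) (ρ : LayerPolicy Γ.X A) (i : Fin m) (y : Fin d → ℝ) : ℝ :=
  pmfExp (Γ.episodeLaw ρ i) fun e => Γ.score i y (Γ.record i e)

variable {Γ : CCECall m d H S A}

theorem pmfExp_episodeLaw (i : Fin m) (ρ : LayerPolicy Γ.X A) {g : Γ.Episode → ℝ} (hg : IsBdd g) :
    pmfExp (Γ.episodeLaw ρ i) g = pmfExp Γ.rollLaw fun z =>
      pmfExp (deviate ρ i z.1 (z.2 i)) fun a => pmfExp (Γ.game.P Γ.h z.1 a) fun y =>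
        g (z, a, y) := by
  rw [episodeLaw, pmfExp_bind _ _ hg]
  congr 1
  ext z
  rw [pmfExp_bind _ _ hg]
  congr 1
  ext a
  rw [pmfExp_map _ _ hg]

namespace IsBounded

variable (i : Fin m)

theorem rollFeat_le (hΓ : Γ.IsBounded) (z : Γ.X × (∀ j, A j)) : Γ.rollFeat i z ⬝ᵥ Γ.rollFeat i z ≤ 1 :=
  hΓ.feat_le i _ _

theorem isBddVec_rollFeat (hΓ : Γ.IsBounded) : IsBddVec (Γ.rollFeat i) := ⟨1, hΓ.rollFeat_le i⟩

theorem ret_mem (hΓ : Γ.IsBounded) {o : Obs Γ.X (S Γ.h.succ) (A i)} (ho : o.loss ∈ Set.Icc (0 : ℝ) 1) :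
    0 ≤ Γ.ret i o ∧ Γ.ret i o ≤ H := by
  have h1 := hΓ.vbar_mem i o.next
  have h2 : (0 : ℝ) ≤ (Γ.h : ℕ) := Nat.cast_nonneg _
  unfold ret
  exact ⟨add_nonneg ho.1 h1.1, by linarith [ho.2]⟩

theorem ret_record_mem (hΓ : Γ.IsBounded) (e : Γ.Episode) :
    0 ≤ Γ.ret i (Γ.record i e) ∧ Γ.ret i (Γ.record i e) ≤ H :=
  hΓ.ret_mem i (Γ.game.loss_mem _ _ _ _)

theorem isBdd_ret_record (hΓ : Γ.IsBounded) : IsBdd fun e => Γ.ret i (Γ.record i e) :=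
  ⟨H, fun e => abs_le.2 ⟨by linarith [(hΓ.ret_record_mem i e).1, (Nat.cast_nonneg H : (0 : ℝ) ≤ H)],
    (hΓ.ret_record_mem i e).2⟩⟩

theorem isBdd_vbar (hΓ : Γ.IsBounded) : IsBdd (Γ.Vbar i) :=
  ⟨(H : ℝ) - ((Γ.h : ℕ) + 1), fun y => by
    rw [abs_of_nonneg (hΓ.vbar_mem i y).1]; exact (hΓ.vbar_mem i y).2⟩

theorem isBdd_backup (hΓ : Γ.IsBounded) (s : Γ.X) : IsBdd (Γ.game.backup i Γ.h (Γ.Vbar i) s) :=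
  IsBdd.add (f := Γ.game.loss i Γ.h s)
    ⟨1, fun a => by
      rw [abs_of_nonneg (Γ.game.loss_mem i Γ.h s a).1]; exact (Γ.game.loss_mem i Γ.h s a).2⟩
    ((hΓ.isBdd_vbar i).pmfExp _)

theorem isBdd_score (hΓ : Γ.IsBounded) (y : Fin d → ℝ) : IsBdd fun e => Γ.score i y (Γ.record i e) :=
  IsBdd.mul (((hΓ.isBddVec_rollFeat i).dotProduct y).comp Prod.fst) (hΓ.isBdd_ret_record i)

/-- Agent i keeps its roll-in action while the others switch to ρ. Given the roll-in sample the mean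
return is therefore φᵀθ, and averaging the score over the sample produces yᵀΣθ. -/
theorem scoreMean_eq (hΓ : Γ.IsBounded) (ρ : LayerPolicy Γ.X A) (y θ : Fin d → ℝ)
    (hθ : ∀ s a, Γ.feat i s a ⬝ᵥ θ =
      pmfExp (deviate ρ i s a) (Γ.game.backup i Γ.h (Γ.Vbar i) s)) :
    Γ.scoreMean ρ i y = momentForm Γ.rollLaw (Γ.rollFeat i) y θ := by
  rw [scoreMean, pmfExp_episodeLaw i ρ (hΓ.isBdd_score i y), momentForm]
  congr 1
  ext z
  simp only [score, record, ret, pmfExp_const_mul]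
  rw [← rollFeat]
  congr 1
  rw [rollFeat, hθ]
  congr 1
  ext a
  rw [pmfExp_add _ (IsBdd.const _) (hΓ.isBdd_vbar i), pmfExp_const]
  rfl

/-- Returns lie in [0, H], and the remaining factor depends on the roll-in sample alone. The bound
is uniform in ρ, as the adaptive choice of policies requires. -/
theorem pmfExp_score_sq_le (hΓ : Γ.IsBounded) (ρ : LayerPolicy Γ.X A) (y : Fin d → ℝ) :
    (pmfExp (Γ.episodeLaw ρ i) fun e => Γ.score i y (Γ.record i e) ^ 2) ≤
      (H : ℝ) ^ 2 * momentForm Γ.rollLaw (Γ.rollFeat i) y y := by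
  have hb : IsBdd fun z => (y ⬝ᵥ Γ.rollFeat i z) * (Γ.rollFeat i z ⬝ᵥ y) :=
    ((hΓ.isBddVec_rollFeat i).dotProduct y).mul ((hΓ.isBddVec_rollFeat i).dotProduct' y)
  have hb' : IsBdd fun e : Γ.Episode =>
      (H : ℝ) ^ 2 * ((y ⬝ᵥ Γ.rollFeat i e.1) * (Γ.rollFeat i e.1 ⬝ᵥ y)) :=
    (IsBdd.const _).mul (hb.comp Prod.fst)
  refine (pmfExp_mono _ (hΓ.isBdd_score i y).pow_two hb' fun e => ?_).trans_eq ?_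
  · have h1 := hΓ.ret_record_mem i e
    rw [dotProduct_comm (Γ.rollFeat i e.1), ← sq, score, mul_pow, mul_comm]
    exact mul_le_mul_of_nonneg_right (pow_le_pow_left₀ h1.1 h1.2 2) (sq_nonneg _)
  · rw [pmfExp_episodeLaw i ρ hb', momentForm, ← pmfExp_const_mul]
    simp only [pmfExp_const]

theorem abs_score_le (hΓ : Γ.IsBounded) {y : Fin d → ℝ} {c : ℝ} (hy : y ⬝ᵥ y ≤ c) (e : Γ.Episode) :
    |Γ.score i y (Γ.record i e)| ≤ Real.sqrt c * H := by
  have h1 := hΓ.ret_record_mem i e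
  rw [score, abs_mul, abs_of_nonneg h1.1]
  refine mul_le_mul ?_ h1.2 h1.1 (Real.sqrt_nonneg _)
  have h2 := abs_dotProduct_le_of_dotProduct_self_le hy (hΓ.rollFeat_le i e.1)
  rwa [mul_one] at h2

theorem scoreMean_sum_smul (hΓ : Γ.IsBounded) (ρ : LayerPolicy Γ.X A) (z : Fin d → ℝ) (n : Fin d → Fin d → ℝ) :
    Γ.scoreMean ρ i (∑ j, z j • n j) = ∑ j, z j * Γ.scoreMean ρ i (n j) := by
  simp only [scoreMean, ← pmfExp_const_mul]
  rw [← pmfExp_sum _ _ fun j => (IsBdd.const (z j)).mul (hΓ.isBdd_score i (n j))]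
  congr 1
  ext e
  rw [score, sum_smul_dotProduct, dotProduct, Finset.sum_mul]
  exact Finset.sum_congr rfl fun j _ => by rw [score, mul_assoc]

end IsBounded

theorem score_sum_smul (i : Fin m) (z : Fin d → ℝ) (n : Fin d → Fin d → ℝ)
    (o : Obs Γ.X (S Γ.h.succ) (A i)) :
    Γ.score i (∑ j, z j • n j) o = ∑ j, z j * Γ.score i (n j) o := by
  rw [score, sum_smul_dotProduct, dotProduct, Finset.sum_mul]
  exact Finset.sum_congr rfl fun j _ => by rw [score, mul_assoc]

section Law

variable [∀ i, Fintype (A i)] [∀ i, Nonempty (A i)]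

/-- The joint policy of round `κ`, given the first `k` rounds. -/
def prefixPolicy (Γ : CCECall m d H S A) (cov mag : Γ.Batch) {k : ℕ} (o : Fin k → Γ.Round)
    (κ : Fin k) : LayerPolicy Γ.X A :=
  Γ.layerPolicy cov mag fun κ' : Fin κ => o (Fin.castLE κ.isLt.le κ')

/-- The deviation of the total score of agent `i` from its predictable part. -/
def scoreDev (Γ : CCECall m d H S A) (cov mag : Γ.Batch) (i : Fin m) (y : Fin d → ℝ) {k : ℕ}
    (o : Fin k → Γ.Round) : ℝ :=
  ∑ κ, (Γ.score i y (o κ i) - Γ.scoreMean (Γ.prefixPolicy cov mag o κ) i y)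

theorem prefixPolicy_snoc_castSucc (cov mag : Γ.Batch) {k : ℕ} (o : Fin k → Γ.Round)
    (r : Γ.Round) (κ : Fin k) :
    Γ.prefixPolicy cov mag (Fin.snoc (α := fun _ => Γ.Round) o r) κ.castSucc =
      Γ.prefixPolicy cov mag o κ := by
  have : (fun κ' : Fin κ => Fin.snoc (α := fun _ => Γ.Round) o r
      (Fin.castSucc (Fin.castLE κ.isLt.le κ'))) = fun κ' : Fin κ => o (Fin.castLE κ.isLt.le κ') :=
    funext fun κ' => Fin.snoc_castSucc (α := fun _ => Γ.Round) r o _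
  exact congrArg (Γ.layerPolicy cov mag) this

theorem prefixPolicy_snoc_last (cov mag : Γ.Batch) {k : ℕ} (o : Fin k → Γ.Round) (r : Γ.Round) :
    Γ.prefixPolicy cov mag (Fin.snoc (α := fun _ => Γ.Round) o r) (Fin.last k) =
      Γ.layerPolicy cov mag o := by
  have : (fun κ' : Fin k => Fin.snoc (α := fun _ => Γ.Round) o r (Fin.castSucc κ')) = o :=
    funext fun κ' => Fin.snoc_castSucc (α := fun _ => Γ.Round) r o _
  exact congrArg (Γ.layerPolicy cov mag) this

/-- Policies are predictable, so a new round leaves the earlier terms untouched and adds one term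
centred given the past: a martingale increment. -/
theorem scoreDev_snoc (cov mag : Γ.Batch) (i : Fin m) (y : Fin d → ℝ) {k : ℕ}
    (o : Fin k → Γ.Round) (r : Γ.Round) :
    Γ.scoreDev cov mag i y (Fin.snoc (α := fun _ => Γ.Round) o r) =
      Γ.scoreDev cov mag i y o +
        (Γ.score i y (r i) - Γ.scoreMean (Γ.layerPolicy cov mag o) i y) := by
  have h1 : ∀ κ : Fin k, Fin.snoc (α := fun _ => Γ.Round) o r κ.castSucc = o κ := fun κ =>
    Fin.snoc_castSucc (α := fun _ => Γ.Round) r o κ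
  have h2 : Fin.snoc (α := fun _ => Γ.Round) o r (Fin.last k) = r :=
    Fin.snoc_last (α := fun _ => Γ.Round) r o
  rw [scoreDev, Fin.sum_univ_castSucc, scoreDev]
  simp only [h1, h2, prefixPolicy_snoc_castSucc, prefixPolicy_snoc_last]

/-- The compensated exponential is a supermartingale: given the past, the factor contributed by the
last round has expectation at most one. -/
theorem pmfLExp_scoreDev_le (cov mag : Γ.Batch) (i : Fin m) (y : Fin d → ℝ) {b v r : ℝ}
    (hb : ∀ e, |Γ.score i y (Γ.record i e)| ≤ b)
    (hv : ∀ ρ, (pmfExp (Γ.episodeLaw ρ i) fun e => Γ.score i y (Γ.record i e) ^ 2) ≤ v)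
    (hr : |r| * b ≤ 1) (k : ℕ) :
    (pmfLExp (Γ.roundsLaw cov mag k) fun o =>
      ENNReal.ofReal (Real.exp (r * Γ.scoreDev cov mag i y o - r ^ 2 * (k * v)))) ≤ 1 := by
  induction k with
  | zero => simp [roundsLaw, pmfLExp_pure, scoreDev]
  | succ k ih =>
    rw [roundsLaw, pmfLExp_bind]
    refine (pmfLExp_mono _ fun o => ?_).trans ih
    rw [pmfLExp_map]
    set ρ := Γ.layerPolicy cov mag o
    have h1 : ∀ x : Γ.Round, ENNReal.ofReal (Real.exp (r * Γ.scoreDev cov mag i y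
        (Fin.snoc (α := fun _ => Γ.Round) o x) - r ^ 2 * ((k + 1 : ℕ) * v))) =
        ENNReal.ofReal (Real.exp (r * Γ.scoreDev cov mag i y o - r ^ 2 * (k * v))) *
        ENNReal.ofReal (Real.exp (r * Γ.score i y (x i) -
          (r * Γ.scoreMean ρ i y + r ^ 2 * v))) := fun x => by
      rw [← ENNReal.ofReal_mul (Real.exp_pos _).le, ← Real.exp_add, scoreDev_snoc]
      congr 2
      push_cast
      ring
    simp only [h1, pmfLExp_const_mul]
    refine mul_le_of_le_one_right' ?_
    rw [pmfLExp_pmfPi_single (fun i => Γ.obsLaw ρ i) i fun x => ENNReal.ofReal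
      (Real.exp (r * Γ.score i y x - (r * Γ.scoreMean ρ i y + r ^ 2 * v))),
      obsLaw_eq_map, pmfLExp_map]
    exact pmfLExp_exp_le _ hb (hv ρ) hr

/-- Concentration of the estimates in the learning rounds, given the covariance batch. -/
theorem scoreDev_concentration (hΓ : Γ.IsBounded) (hH : 0 < H) (cov mag : Γ.Batch) (i : Fin m)
    {W : Matrix (Fin d) (Fin d) ℝ} (hW : W.PosDef) {g R t : ℝ} (hg : 0 < g) (ht : 0 < t)
    (hWg : ∀ y, g * (y ⬝ᵥ y) ≤ y ⬝ᵥ (W *ᵥ y))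
    (hWR : ∀ y, momentForm Γ.rollLaw (Γ.rollFeat i) y y ≤ R * (y ⬝ᵥ (W *ᵥ y))) (k : ℕ) :
    (Γ.roundsLaw cov mag k).toOuterMeasure
      {o | ¬ ∀ y, Γ.scoreDev cov mag i y o ^ 2 ≤ (y ⬝ᵥ (W *ᵥ y)) *
        (d * (2 * Real.sqrt (k * ((H : ℝ) ^ 2 * R) * t) + Real.sqrt (1 / g) * H * t) ^ 2)} ≤
      d * (2 * ENNReal.ofReal (Real.exp (-t))) := by
  obtain ⟨n, hn, hspan⟩ := exists_whitening hW
  have hn1 : ∀ j, n j ⬝ᵥ (W *ᵥ n j) = 1 := fun j => by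
    have h1 := hn (Pi.single j 1)
    have h2 : ∑ l, (Pi.single j 1 : Fin d → ℝ) l • n l = n j := by
      simp [Pi.single_apply]
    rw [h2] at h1
    simpa using h1
  have hnn : ∀ j, n j ⬝ᵥ n j ≤ 1 / g := fun j => by
    rw [le_div_iff₀ hg, mul_comm, ← hn1 j]
    exact hWg _
  have hv : ∀ j ρ, (pmfExp (Γ.episodeLaw ρ i) fun e => Γ.score i (n j) (Γ.record i e) ^ 2) ≤
      (H : ℝ) ^ 2 * R := fun j ρ => by
    refine (hΓ.pmfExp_score_sq_le i ρ (n j)).trans (mul_le_mul_of_nonneg_left ?_ (sq_nonneg _))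
    have := hWR (n j)
    rwa [hn1, mul_one] at this
  -- The sign is read off the second moment bound, which needs a direction and some policy; the
  -- policy before any round serves.
  have hR : ∀ _ : Fin d, 0 ≤ (H : ℝ) ^ 2 * R := fun j =>
    (pmfExp_nonneg (Γ.episodeLaw (fun s => Γ.layerPolicy cov mag
      (fun κ : Fin 0 => κ.elim0) s) i) fun e => sq_nonneg _).trans (hv j _)
  have hH' : (0 : ℝ) < H := Nat.cast_pos.2 hH
  have hunion := toOuterMeasure_iUnion_le (Γ.roundsLaw cov mag k) _ fun j : Fin d =>
    bernstein_tail (Γ.roundsLaw cov mag k) (fun o => Γ.scoreDev cov mag i (n j) o)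
      (b := Real.sqrt (1 / g) * H) (w := k * ((H : ℝ) ^ 2 * R))
      (mul_pos (Real.sqrt_pos.2 (one_div_pos.2 hg)) hH') ht
      (mul_nonneg (Nat.cast_nonneg k) (hR j))
      fun r hr => pmfLExp_scoreDev_le cov mag i (n j) (hΓ.abs_score_le i (hnn j)) (hv j) hr k
  rw [Fintype.card_fin] at hunion
  refine (MeasureTheory.measure_mono ?_).trans hunion
  intro o ho
  by_contra ho2
  refine ho fun y => ?_
  rw [Set.mem_iUnion, not_exists] at ho2
  obtain ⟨z, rfl⟩ := hspan y
  rw [hn]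
  have hlin : Γ.scoreDev cov mag i (∑ j, z j • n j) o =
      ∑ j, z j * Γ.scoreDev cov mag i (n j) o := by
    simp only [scoreDev, Finset.mul_sum]
    rw [Finset.sum_comm]
    refine Finset.sum_congr rfl fun κ _ => ?_
    rw [score_sum_smul, hΓ.scoreMean_sum_smul, ← Finset.sum_sub_distrib]
    exact Finset.sum_congr rfl fun j _ => by ring
  rw [hlin]
  refine (Finset.sum_mul_sq_le_sq_mul_sq _ _ _).trans ?_
  have e : ∑ j, z j ^ 2 = z ⬝ᵥ z := by simp only [dotProduct, sq]
  rw [e]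
  refine mul_le_mul_of_nonneg_left ?_ (dotProduct_self_nonneg' z)
  refine (Finset.sum_le_sum fun j _ => ?_).trans (b := ∑ _j : Fin d,
    (2 * Real.sqrt (k * ((H : ℝ) ^ 2 * R) * t) + Real.sqrt (1 / g) * H * t) ^ 2) (by simp)
  rw [← sq_abs]
  exact pow_le_pow_left₀ (abs_nonneg _) (not_lt.1 (ho2 j)) 2

end Law

end CCECall

/-! ### Vector-valued measures -/

section VectorMeasure

variable {Y : Type*} {d : ℕ}

/-- Integration of a bounded function against a vector-valued discrete measure. -/
theorem exists_vector_integral {μ : Y → Fin d → ℝ}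
    (hμ : ∀ (F : Finset Y) (f : Y → ℝ), (∀ y, |f y| ≤ 1) →
      ‖WithLp.toLp 2 (∑ y ∈ F, f y • μ y)‖ ≤ Real.sqrt d)
    {g : Y → ℝ} {c : ℝ} (hc : 0 < c) (hg : ∀ y, |g y| ≤ c) :
    ∃ w : Fin d → ℝ, w ⬝ᵥ w ≤ c ^ 2 * d ∧ ∀ φ : Fin d → ℝ, φ ⬝ᵥ w = ∑' y, (φ ⬝ᵥ μ y) * g y := by
  have hfin : ∀ (F : Finset Y) (f : Y → ℝ), (∀ y, |f y| ≤ 1) →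
      (∑ y ∈ F, f y • μ y) ⬝ᵥ (∑ y ∈ F, f y • μ y) ≤ d := fun F f hf => by
    have h1 := pow_le_pow_left₀ (norm_nonneg _) (hμ F f hf) 2
    rwa [norm_toLp_sq, Real.sq_sqrt (Nat.cast_nonneg d)] at h1
  have habs : ∀ j, Summable fun y => |μ y j| := fun j => by
    refine summable_of_sum_le (c := Real.sqrt d) (fun y => abs_nonneg _) fun F => ?_
    -- Testing against the sign of the j-th coordinate makes the finite sums those of |μ j|, which
    -- are thus bounded by √d.
    have h1 := (sq_apply_le_dotProduct_self _ j).trans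
      (hfin F (fun y => (SignType.sign (μ y j) : ℝ)) fun y => by
        rcases lt_trichotomy (μ y j) 0 with h | h | h <;> simp [h])
    refine le_trans (le_of_eq ?_) (Real.abs_le_sqrt h1 |> (le_abs_self _).trans)
    rw [Finset.sum_apply]
    refine Finset.sum_congr rfl fun y _ => ?_
    rw [Pi.smul_apply, smul_eq_mul, sign_mul_self]
  have hsum : ∀ j, Summable fun y => g y * μ y j := fun j => by
    refine Summable.of_norm_bounded ((habs j).mul_left c) fun y => ?_
    rw [Real.norm_eq_abs, abs_mul]
    exact mul_le_mul_of_nonneg_right (hg y) (abs_nonneg _)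
  refine ⟨fun j => ∑' y, g y * μ y j, ?_, fun φ => ?_⟩
  · have h1 : HasSum (fun y => g y • μ y) fun j => ∑' y, g y * μ y j :=
      Pi.hasSum.2 fun j => (hsum j).hasSum
    have hcont : Continuous fun w : Fin d → ℝ => w ⬝ᵥ w := by
      unfold dotProduct
      fun_prop
    -- The norm bound is known for finite partial sums and passes to their limit by continuity.
    refine le_of_tendsto ((hcont.tendsto _).comp h1) (Filter.Eventually.of_forall fun F => ?_)
    have h2 : ∑ y ∈ F, g y • μ y = c • ∑ y ∈ F, (g y / c) • μ y := by
      rw [Finset.smul_sum]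
      refine Finset.sum_congr rfl fun y _ => ?_
      rw [smul_smul, mul_div_cancel₀ _ hc.ne']
    show (∑ y ∈ F, g y • μ y) ⬝ᵥ (∑ y ∈ F, g y • μ y) ≤ _
    rw [h2, smul_dotProduct, dotProduct_smul, smul_eq_mul, smul_eq_mul, ← mul_assoc, ← sq]
    refine mul_le_mul_of_nonneg_left (hfin F _ fun y => ?_) (sq_nonneg c)
    rw [abs_div, abs_of_pos hc, div_le_one hc]
    exact hg y
  · have h1 : HasSum (fun y => ∑ j, φ j * (g y * μ y j)) (∑ j, φ j * ∑' y, g y * μ y j) :=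
      hasSum_sum fun j _ => (hsum j).hasSum.mul_left _
    rw [dotProduct, ← h1.tsum_eq]
    refine tsum_congr fun y => ?_
    rw [dotProduct, Finset.sum_mul]
    exact Finset.sum_congr rfl fun j _ => by ring

end VectorMeasure

theorem pmfPi_support_apply {n : ℕ} {α : Fin n → Type u} (p : ∀ i, PMF (α i)) {x : ∀ i, α i}
    (hx : x ∈ (pmfPi p).support) (i : Fin n) : x i ∈ (p i).support := by
  rw [PMF.mem_support_iff, pmfPi_apply] at hx
  exact (PMF.mem_support_iff _ _).2 (Finset.prod_ne_zero_iff.1 hx i (Finset.mem_univ i))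

/-! ### Numerical estimates -/

section Numerics

variable {d K H l L q : ℝ}

theorem sq_rate_eq (hK : 1 ≤ K) (α : ℝ) :
    (α * (1000 * (d * H / Real.sqrt K) * L * q)) ^ 2 =
      α ^ 2 * (1000000 * d ^ 2 * H ^ 2 * L ^ 2 * q ^ 2) / K := by
  have h : Real.sqrt K ^ 2 = K := Real.sq_sqrt (by linarith)
  have : (α * (1000 * (d * H / Real.sqrt K) * L * q)) ^ 2 =
      α ^ 2 * (1000000 * d ^ 2 * H ^ 2 * L ^ 2 * q ^ 2) / Real.sqrt K ^ 2 := by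
    field_simp
    ring
  rw [this, h]

/-- Every contribution is controlled through its square, so comparing squares after clearing K
avoids handling √K and √q. -/
theorem le_rate_of_sq_le (hd : 1 ≤ d) (hK : 1 ≤ K) (hH : 1 ≤ H) (hL : 1 ≤ L) (hq : 0 ≤ q)
    {α e X : ℝ} (hα : 0 ≤ α) (he : e ^ 2 ≤ X)
    (hX : X * K ≤ α ^ 2 * (1000000 * d ^ 2 * H ^ 2 * L ^ 2 * q ^ 2)) :
    e ≤ α * (1000 * (d * H / Real.sqrt K) * L * q) := by
  refine (abs_le_of_sq_le_sq' (he.trans ?_) (by positivity)).2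
  rw [sq_rate_eq hK, le_div_iff₀ (by linarith)]
  exact hX

/-- For K ≤ d the lower bound on q reads K ≤ 6d²lq, strong enough to absorb the deterministic
estimate of a single round without any concentration. -/
theorem crude_le_rate (hd : 1 ≤ d) (hK : 1 ≤ K) (hH : 1 ≤ H) (hl : 1 ≤ l) (hlL : l ≤ L)
    (hq0 : 0 ≤ q) (hq : K ≤ q * (K + 5 * d ^ 2 * l)) (hKd : K ≤ d) {e : ℝ}
    (he : e ^ 2 ≤ H ^ 2 * (q / (5 * d / K * l))) :
    e ≤ 1000 * (d * H / Real.sqrt K) * L * q := by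
  rw [← one_mul (1000 * (d * H / Real.sqrt K) * L * q)]
  refine le_rate_of_sq_le hd hK hH (hl.trans hlL) hq0 zero_le_one he ?_
  have h1 : K ≤ 6 * d ^ 2 * l * q := by
    have : K ≤ d ^ 2 * l := by nlinarith
    nlinarith
  have h2 : H ^ 2 * (q / (5 * d / K * l)) * K = H ^ 2 * q * (K ^ 2 / (5 * d * l)) := by
    field_simp
  have h3 : (1 : ℝ) ^ 2 * (1000000 * d ^ 2 * H ^ 2 * L ^ 2 * q ^ 2) =
      H ^ 2 * q * (1000000 * d ^ 2 * L ^ 2 * q) := by ring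
  rw [h2, h3]
  refine mul_le_mul_of_nonneg_left ?_ (by positivity)
  rw [div_le_iff₀ (by positivity)]
  have hL2 : 1 ≤ L ^ 2 := by nlinarith
  calc K ^ 2 ≤ d * (6 * d ^ 2 * l * q) := by nlinarith
    _ = 6 * (d ^ 3 * l * q) * 1 := by ring
    _ ≤ 5000000 * (d ^ 3 * l * q) * L ^ 2 := by
        have : 0 ≤ d ^ 3 * l * q := by positivity
        nlinarith
    _ = _ := by ring

/-- For d ≤ K the lower bound gives 6dlq ≥ 1. One such factor upgrades the squared deviation, linear
in q, to the required q², and the spare factor 1/l in the variance pays for the l. -/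
theorem martingale_le_rate (hd : 1 ≤ d) (hK : 1 ≤ K) (hH : 1 ≤ H) (hl : 1 ≤ l) (hlL : l ≤ L)
    (hq0 : 0 ≤ q) (hq : K ≤ q * (K + 5 * d ^ 2 * l)) (hKd : d ≤ K) {e : ℝ}
    (he : e ^ 2 ≤ q * (d * (2 * Real.sqrt (K * (H ^ 2 * (14 * L / l)) * (2 * L)) +
      Real.sqrt (1 / (5 * d / K * l)) * H * (2 * L)) ^ 2)) :
    e ≤ K / 2 * (1000 * (d * H / Real.sqrt K) * L * q) := by
  refine le_rate_of_sq_le hd hK hH (hl.trans hlL) hq0 (by linarith) he ?_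
  have h1 : 1 ≤ 6 * d * l * q := by
    have h : K + 5 * d ^ 2 * l ≤ 6 * d * l * K := by
      have : 1 ≤ d * l := by nlinarith
      nlinarith [mul_le_mul_of_nonneg_left hKd (by positivity : (0 : ℝ) ≤ d * l)]
    have : K * 1 ≤ K * (6 * d * l * q) := by nlinarith
    exact le_of_mul_le_mul_left this (by linarith)
  have hL : 1 ≤ L := hl.trans hlL
  set a := 2 * Real.sqrt (K * (H ^ 2 * (14 * L / l)) * (2 * L))
  set b := Real.sqrt (1 / (5 * d / K * l)) * H * (2 * L)
  have ha : a ^ 2 = K * H ^ 2 * L ^ 2 * (112 / l) := by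
    simp only [a]
    rw [mul_pow, Real.sq_sqrt (by positivity)]
    field_simp
    ring
  have hb : b ^ 2 = K * H ^ 2 * L ^ 2 * (4 / (5 * d * l)) := by
    simp only [b]
    rw [mul_pow, mul_pow, Real.sq_sqrt (by positivity)]
    field_simp
    ring
  have hab : (a + b) ^ 2 ≤ K * H ^ 2 * L ^ 2 * (226 / l) := by
    have h4 : 4 / (5 * d * l) ≤ 1 / l := by
      rw [div_le_div_iff₀ (by positivity) (by positivity)]
      nlinarith
    have h5 : K * H ^ 2 * L ^ 2 * (4 / (5 * d * l)) ≤ K * H ^ 2 * L ^ 2 * (1 / l) :=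
      mul_le_mul_of_nonneg_left h4 (by positivity)
    have h6 : K * H ^ 2 * L ^ 2 * (226 / l) =
        2 * (K * H ^ 2 * L ^ 2 * (112 / l)) + 2 * (K * H ^ 2 * L ^ 2 * (1 / l)) := by ring
    rw [h6]
    nlinarith [sq_nonneg (a - b)]
  calc q * (d * (a + b) ^ 2) * K ≤ q * (d * (K * H ^ 2 * L ^ 2 * (226 / l))) * K := by gcongr
    _ = K ^ 2 * H ^ 2 * L ^ 2 * q * d * (226 / l) := by ring
    _ ≤ K ^ 2 * H ^ 2 * L ^ 2 * q * d * (250000 * (d * q)) := by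
        refine mul_le_mul_of_nonneg_left ?_ (by positivity)
        rw [div_le_iff₀ (by positivity)]
        nlinarith
    _ = _ := by ring

/-- For K ≤ d² the drift needs no comparison between Σ and Σ̂: its size H times the norm of x under
Σ suffices, again by K ≤ 6d²lq. -/
theorem drift_le_rate (hd : 1 ≤ d) (hK : 1 ≤ K) (hH : 1 ≤ H) (hl : 1 ≤ l) (hlL : l ≤ L)
    (hq0 : 0 ≤ q) (hq : K ≤ q * (K + 5 * d ^ 2 * l)) (hKd : K ≤ d ^ 2) {e : ℝ}
    (he : e ^ 2 ≤ 14 * L / l * q * H ^ 2) :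
    e ≤ 1 / 2 * (1000 * (d * H / Real.sqrt K) * L * q) := by
  have hL : 1 ≤ L := hl.trans hlL
  refine le_rate_of_sq_le hd hK hH hL hq0 (by norm_num) he ?_
  have h1 : K ≤ 6 * d ^ 2 * l * q := by
    have : K ≤ d ^ 2 * l := by nlinarith [sq_nonneg d]
    nlinarith
  calc 14 * L / l * q * H ^ 2 * K = q * H ^ 2 * L * (14 * K / l) := by ring
    _ ≤ q * H ^ 2 * L * (84 * (d ^ 2 * q)) := by
        refine mul_le_mul_of_nonneg_left ?_ (by positivity)
        rw [div_le_iff₀ (by positivity)]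
        nlinarith
    _ = 84 * (q ^ 2 * H ^ 2 * d ^ 2 * L) * 1 := by ring
    _ ≤ 84 * (q ^ 2 * H ^ 2 * d ^ 2 * L) * L := by gcongr
    _ ≤ 250000 * (q ^ 2 * H ^ 2 * d ^ 2 * L) * L := by gcongr; norm_num
    _ = _ := by ring

theorem one_le_of_sq_le (hK : 1 ≤ K) (hl : 1 ≤ l) (hq0 : 0 ≤ q)
    (hq : K ≤ q * (K + 5 * d ^ 2 * l)) (hKd : d ^ 2 ≤ K) : 1 ≤ 6 * l * q := by
  have h : K + 5 * d ^ 2 * l ≤ 6 * l * K := by nlinarith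
  have : K * 1 ≤ K * (6 * l * q) := by nlinarith
  exact le_of_mul_le_mul_left this (by linarith)

/-- For d² ≤ K the lower bound on q no longer involves d (`one_le_of_sq_le`), so the factor d² from
the sampling error is exactly the one allowed. -/
theorem sampling_le_rate (hd : 1 ≤ d) (hK : 1 ≤ K) (hH : 1 ≤ H) (hl : 1 ≤ l) (hlL : l ≤ L)
    (hq0 : 0 ≤ q) (hq : K ≤ q * (K + 5 * d ^ 2 * l)) (hKd : d ^ 2 ≤ K) {e : ℝ}
    (he : e ^ 2 ≤ 9 * d * (2 * L) / K * ((2 * H) ^ 2 * d) * (2 * (14 * L / l) * q)) :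
    e ≤ 1 / 4 * (1000 * (d * H / Real.sqrt K) * L * q) := by
  have hL : 1 ≤ L := hl.trans hlL
  refine le_rate_of_sq_le hd hK hH hL hq0 (by norm_num) he ?_
  have h1 := one_le_of_sq_le hK hl hq0 hq hKd
  calc _ = d ^ 2 * H ^ 2 * L ^ 2 * q * (2016 / l) := by field_simp; ring
    _ ≤ d ^ 2 * H ^ 2 * L ^ 2 * q * (62500 * q) := by
        refine mul_le_mul_of_nonneg_left ?_ (by positivity)
        rw [div_le_iff₀ (by positivity)]
        nlinarith
    _ = _ := by ring

theorem regularisation_le_rate (hd : 1 ≤ d) (hK : 1 ≤ K) (hH : 1 ≤ H) (hl : 1 ≤ l) (hlL : l ≤ L)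
    (hq0 : 0 ≤ q) (hq : K ≤ q * (K + 5 * d ^ 2 * l)) (hKd : d ^ 2 ≤ K) {e : ℝ}
    (he : e ^ 2 ≤ 5 * d / K * l * q * ((2 * H) ^ 2 * d)) :
    e ≤ 1 / 4 * (1000 * (d * H / Real.sqrt K) * L * q) := by
  have hL : 1 ≤ L := hl.trans hlL
  refine le_rate_of_sq_le hd hK hH hL hq0 (by norm_num) he ?_
  have h1 := one_le_of_sq_le hK hl hq0 hq hKd
  calc _ = d ^ 2 * H ^ 2 * q * (20 * l * 1) := by field_simp; ring
    _ ≤ d ^ 2 * H ^ 2 * q * (20 * l * (6 * l * q)) := by gcongr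
    _ = d ^ 2 * H ^ 2 * q * (120 * q * l ^ 2) := by ring
    _ ≤ d ^ 2 * H ^ 2 * q * (62500 * q * L ^ 2) := by gcongr; norm_num
    _ = _ := by ring

end Numerics

/-- Nonnegativity of the variance. -/
theorem pmfExp_sq_le {α : Type*} (p : PMF α) {X : α → ℝ} (hX : IsBdd X) :
    pmfExp p X ^ 2 ≤ pmfExp p fun x => X x ^ 2 := by
  set c := pmfExp p X
  have h1 : 0 ≤ pmfExp p fun x => (X x ^ 2 + (-2 * c) * X x) + c ^ 2 :=
    pmfExp_nonneg p fun x => by nlinarith [sq_nonneg (X x - c)]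
  rw [pmfExp_add p (hX.pow_two.add ((IsBdd.const _).mul hX)) (IsBdd.const _),
    pmfExp_add p hX.pow_two ((IsBdd.const _).mul hX), pmfExp_const_mul, pmfExp_const] at h1
  nlinarith

theorem momentForm_sq_le {Z : Type u} {d : ℕ} (p : PMF Z) {f : Z → Fin d → ℝ} (hf : IsBddVec f)
    {θ : Fin d → ℝ} {c : ℝ} (hθ : ∀ z, 0 ≤ f z ⬝ᵥ θ ∧ f z ⬝ᵥ θ ≤ c) (y : Fin d → ℝ) :
    momentForm p f y θ ^ 2 ≤ momentForm p f y y * c ^ 2 := by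
  refine (pmfExp_sq_le p ((hf.dotProduct y).mul (hf.dotProduct' θ))).trans ?_
  rw [mul_comm, momentForm, ← pmfExp_const_mul]
  refine pmfExp_mono p ((hf.dotProduct y).mul (hf.dotProduct' θ)).pow_two
    ((IsBdd.const _).mul ((hf.dotProduct y).mul (hf.dotProduct' y))) fun z => ?_
  rw [mul_pow, dotProduct_comm (f z) y, ← sq, mul_comm]
  exact mul_le_mul_of_nonneg_right (pow_le_pow_left₀ (hθ z).1 (hθ z).2 2) (sq_nonneg _)

namespace CCECall

variable {m d H : ℕ} {S : Fin (H + 1) → Type u} {A : Fin m → Type v} {Γ : CCECall m d H S A}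

/-! ### Consequences of independent linear function approximation -/

theorem isBounded_of_independentLinear {Pest : ∀ h : Fin H, Set (LayerPolicy (S h.castSucc) A)}
    (hV : ∀ i y, 0 ≤ Γ.Vbar i y ∧ Γ.Vbar i y ≤ (H : ℝ) - ((Γ.h : ℕ) + 1))
    (hG : Γ.game.IndependentLinear Γ.φ Pest) : Γ.IsBounded where
  feat_le i s a := by
    rw [← norm_toLp_sq]
    exact pow_le_one₀ (norm_nonneg _) (hG.1 i Γ.h s a)
  vbar_mem := hV

/-- Integrate the constant 1 against μ: the total transition mass is one. This is the source of the
lower bound on q. -/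
theorem exists_unit_vector {Pest : ∀ h : Fin H, Set (LayerPolicy (S h.castSucc) A)}
    (hG : Γ.game.IndependentLinear Γ.φ Pest) (i : Fin m) {ρ : LayerPolicy Γ.X A}
    (hρ : ρ ∈ Pest Γ.h) :
    ∃ w : Fin d → ℝ, w ⬝ᵥ w ≤ d ∧ ∀ s a, Γ.feat i s a ⬝ᵥ w = 1 := by
  obtain ⟨μ, ν, h1, -, h3, -⟩ := hG.2 i Γ.h ρ hρ
  obtain ⟨w, hw, hφ⟩ := exists_vector_integral h3 (g := fun _ => 1) one_pos (by simp)
  refine ⟨w, by simpa using hw, fun s a => ?_⟩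
  refine (hφ _).trans (Eq.trans ?_
    (hasSum_toReal ((deviate ρ i s a).bind (Γ.game.P Γ.h s))).tsum_eq)
  refine tsum_congr fun y => ?_
  rw [h1, mul_one]
  rfl

/-- θ is ν plus the integral of V̄ against μ. The norm bound is the point: a parameter fixed only by
its values on the features could be arbitrarily long. -/
theorem exists_parameter {Pest : ∀ h : Fin H, Set (LayerPolicy (S h.castSucc) A)}
    (hΓ : Γ.IsBounded) (hH : 0 < H) (hG : Γ.game.IndependentLinear Γ.φ Pest) (i : Fin m)
    {ρ : LayerPolicy Γ.X A} (hρ : ρ ∈ Pest Γ.h) :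
    ∃ θ : Fin d → ℝ, θ ⬝ᵥ θ ≤ (2 * (H : ℝ)) ^ 2 * d ∧ ∀ s a, Γ.feat i s a ⬝ᵥ θ =
      pmfExp (deviate ρ i s a) (Γ.game.backup i Γ.h (Γ.Vbar i) s) := by
  obtain ⟨μ, ν, h1, h2, h3, h4⟩ := hG.2 i Γ.h ρ hρ
  have hH' : (1 : ℝ) ≤ H := Nat.one_le_cast.2 hH
  obtain ⟨w, hw, hφ⟩ := exists_vector_integral h3 (g := Γ.Vbar i) (c := H) (by linarith)
    fun y => by
      rw [abs_of_nonneg (hΓ.vbar_mem i y).1]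
      linarith [(hΓ.vbar_mem i y).2, (Nat.cast_nonneg _ : (0 : ℝ) ≤ (Γ.h : ℕ))]
  refine ⟨ν + w, ?_, fun s a => ?_⟩
  · have h5 : ν ⬝ᵥ ν ≤ d := by
      rw [← norm_toLp_sq, ← Real.sq_sqrt (Nat.cast_nonneg d : (0 : ℝ) ≤ d)]
      exact pow_le_pow_left₀ (norm_nonneg _) h4 2
    have h6 := dotProduct_self_nonneg' (ν - w)
    have h7 : (ν + w) ⬝ᵥ (ν + w) = 2 * (ν ⬝ᵥ ν) + 2 * (w ⬝ᵥ w) - (ν - w) ⬝ᵥ (ν - w) := by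
      simp only [add_dotProduct, dotProduct_add, sub_dotProduct, dotProduct_sub,
        dotProduct_comm w ν]
      ring
    have h8 : (d : ℝ) ≤ (H : ℝ) ^ 2 * d :=
      le_mul_of_one_le_left (Nat.cast_nonneg d) (one_le_pow₀ hH')
    nlinarith
  · have hl : IsBdd (Γ.game.loss i Γ.h s) := ⟨1, fun b => by
      rw [abs_of_nonneg (Γ.game.loss_mem i Γ.h s b).1]; exact (Γ.game.loss_mem i Γ.h s b).2⟩
    have h5 : pmfExp (deviate ρ i s a) (Γ.game.backup i Γ.h (Γ.Vbar i) s) =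
        pmfExp (deviate ρ i s a) (Γ.game.loss i Γ.h s) +
          pmfExp (deviate ρ i s a) fun b => pmfExp (Γ.game.P Γ.h s b) (Γ.Vbar i) :=
      pmfExp_add _ hl ((hΓ.isBdd_vbar i).pmfExp _)
    rw [h5, h2, dotProduct_add, ← pmfExp_bind _ _ (hΓ.isBdd_vbar i), hφ, pmfExp]
    simp only [h1]
    rfl

theorem IsBounded.pmfExp_backup_mem (hΓ : Γ.IsBounded) (i : Fin m) (ρ : LayerPolicy Γ.X A)
    (s : Γ.X) (a : A i) :
    0 ≤ pmfExp (deviate ρ i s a) (Γ.game.backup i Γ.h (Γ.Vbar i) s) ∧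
      pmfExp (deviate ρ i s a) (Γ.game.backup i Γ.h (Γ.Vbar i) s) ≤ H := by
  refine ⟨pmfExp_nonneg _ fun b => ?_, pmfExp_le_of_le _ (hΓ.isBdd_backup i s) fun b => ?_⟩
  · exact add_nonneg (Γ.game.loss_mem i Γ.h s b).1 (pmfExp_nonneg _ fun y => (hΓ.vbar_mem i y).1)
  · have h1 := pmfExp_le_of_le (Γ.game.P Γ.h s b) (hΓ.isBdd_vbar i) fun y => (hΓ.vbar_mem i y).2
    have h2 := (Γ.game.loss_mem i Γ.h s b).2
    have h3 : (0 : ℝ) ≤ (Γ.h : ℕ) := Nat.cast_nonneg _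
    unfold MarkovGame.backup
    linarith

/-! ### The regularised design matrix -/

/-- The matrix whose inverse is `Σ̂†`. -/
def designMatrix (Γ : CCECall m d H S A) (cov : Γ.Batch) (i : Fin m) :
    Matrix (Fin d) (Fin d) ℝ :=
  (1 / (Γ.K : ℝ)) • ∑ κ, Matrix.vecMulVec (Γ.feat i (cov κ).1 ((cov κ).2 i))
      (Γ.feat i (cov κ).1 ((cov κ).2 i)) + Γ.γ • (1 : Matrix (Fin d) (Fin d) ℝ)

theorem designMatrix_form (cov : Γ.Batch) (i : Fin m) (y w : Fin d → ℝ) :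
    y ⬝ᵥ (Γ.designMatrix cov i *ᵥ w) = sampleForm cov (Γ.rollFeat i) y w + Γ.γ * (y ⬝ᵥ w) := by
  rw [designMatrix, Matrix.add_mulVec, dotProduct_add, Matrix.smul_mulVec, Matrix.smul_mulVec,
    Matrix.one_mulVec, dotProduct_smul, dotProduct_smul, smul_eq_mul, smul_eq_mul, sampleForm,
    Matrix.sum_mulVec, dotProduct_sum]
  congr 2
  refine Finset.sum_congr rfl fun κ _ => ?_
  rw [Matrix.vecMulVec_mulVec, dotProduct_smul]
  simp [rollFeat]

theorem designMatrix_transpose (cov : Γ.Batch) (i : Fin m) :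
    (Γ.designMatrix cov i)ᵀ = Γ.designMatrix cov i := by
  simp [designMatrix, Matrix.transpose_sum, Matrix.transpose_vecMulVec]

theorem le_designMatrix_form (cov : Γ.Batch) (i : Fin m) (y : Fin d → ℝ) :
    Γ.γ * (y ⬝ᵥ y) ≤ y ⬝ᵥ (Γ.designMatrix cov i *ᵥ y) := by
  rw [designMatrix_form]
  linarith [sampleForm_self_nonneg cov (Γ.rollFeat i) y]

theorem posDef_designMatrix (hγ : 0 < Γ.γ) (cov : Γ.Batch) (i : Fin m) :
    (Γ.designMatrix cov i).PosDef :=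
  Matrix.posDef_of_form hγ
    (by rw [Matrix.IsHermitian, Matrix.conjTranspose_eq_transpose_of_trivial,
      designMatrix_transpose])
    (le_designMatrix_form cov i)

theorem designMatrix_mulVec_sigmaInv (hγ : 0 < Γ.γ) (cov : Γ.Batch) (i : Fin m)
    (φ : Fin d → ℝ) : Γ.designMatrix cov i *ᵥ (Γ.sigmaInv cov i *ᵥ φ) = φ := by
  have h : Γ.sigmaInv cov i = (Γ.designMatrix cov i)⁻¹ := rfl
  rw [h, Matrix.mulVec_mulVec, Matrix.mul_nonsing_inv _
    (isUnit_iff_ne_zero.2 (posDef_designMatrix hγ cov i).det_pos.ne'), Matrix.one_mulVec]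

theorem dotProduct_sigmaInv_comm (cov : Γ.Batch) (i : Fin m) (x y : Fin d → ℝ) :
    x ⬝ᵥ (Γ.sigmaInv cov i *ᵥ y) = (Γ.sigmaInv cov i *ᵥ x) ⬝ᵥ y := by
  have h : (Γ.sigmaInv cov i)ᵀ = Γ.sigmaInv cov i := by
    rw [show Γ.sigmaInv cov i = (Γ.designMatrix cov i)⁻¹ from rfl, Matrix.transpose_nonsing_inv,
      designMatrix_transpose]
  rw [Matrix.dotProduct_mulVec, ← Matrix.mulVec_transpose, h]

theorem sigmaInv_form_nonneg (hγ : 0 < Γ.γ) (cov : Γ.Batch) (i : Fin m) (φ : Fin d → ℝ) :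
    0 ≤ φ ⬝ᵥ (Γ.sigmaInv cov i *ᵥ φ) := by
  have h1 := le_designMatrix_form cov i (Γ.sigmaInv cov i *ᵥ φ)
  rw [designMatrix_mulVec_sigmaInv hγ] at h1
  rw [dotProduct_comm]
  exact (mul_nonneg hγ.le (dotProduct_self_nonneg' _)).trans h1

/-- The bonus dominates its first part. -/
theorem le_bonus (hΓ : Γ.IsBounded) (hγ : 0 < Γ.γ) (hβ : 0 ≤ Γ.β₂) (cov : Γ.Batch) (i : Fin m)
    (s : Γ.X) (a : A i) :
    Γ.β₁ * (Γ.feat i s a ⬝ᵥ (Γ.sigmaInv cov i *ᵥ Γ.feat i s a)) ≤ Γ.bonus cov i s a := by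
  refine le_add_of_nonneg_right (mul_nonneg hβ ?_)
  set φ := Γ.feat i s a
  refine (sigmaInv_form_nonneg hγ cov i φ).trans (Finset.sum_le_sum fun j _ => ?_)
  refine le_ciSup (f := fun p : Γ.X × A i => φ j * (Γ.sigmaInv cov i *ᵥ Γ.feat i p.1 p.2) j)
    ?_ (s, a)
  -- The supremum exceeds its value at (s, a) only because the range is bounded; an unbounded real
  -- supremum would default to zero.
  have hb : ∀ p : Γ.X × A i, |φ j * (Γ.sigmaInv cov i *ᵥ Γ.feat i p.1 p.2) j| ≤
      |φ j| * Real.sqrt (((Γ.sigmaInv cov i).row j ⬝ᵥ (Γ.sigmaInv cov i).row j) * 1) := fun p => by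
    rw [abs_mul]
    exact mul_le_mul_of_nonneg_left
      (abs_dotProduct_le_of_dotProduct_self_le le_rfl (hΓ.feat_le i p.1 p.2)) (abs_nonneg _)
  exact ⟨|φ j| * Real.sqrt (((Γ.sigmaInv cov i).row j ⬝ᵥ (Γ.sigmaInv cov i).row j) * 1),
    Set.forall_mem_range.2 fun p => (le_abs_self _).trans (hb p)⟩

/-- The covariance batch represents the roll-in distribution well. -/
def CovGood (Γ : CCECall m d H S A) (t : ℝ) (cov : Γ.Batch) (i : Fin m) : Prop :=
  (∀ y, momentForm Γ.rollLaw (Γ.rollFeat i) y y ≤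
    2 * sampleForm cov (Γ.rollFeat i) y y + 33 * d * t / Γ.K * (y ⬝ᵥ y)) ∧
  ∀ y θ, (momentForm Γ.rollLaw (Γ.rollFeat i) y θ - sampleForm cov (Γ.rollFeat i) y θ) ^ 2 ≤
    9 * d * t / Γ.K * (θ ⬝ᵥ θ) *
      (momentForm Γ.rollLaw (Γ.rollFeat i) y y + 33 * d * t / Γ.K * (y ⬝ᵥ y))

/-- γ carries the logarithm l while the concentration level is 2L. The factor 14L/l bridges the two:
it turns γ into 70dL/K, which covers the 66dL/K of the concentration bound. -/
theorem CovGood.momentForm_le {cov : Γ.Batch} {i : Fin m} {l L : ℝ}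
    (h : Γ.CovGood (2 * L) cov i) (hl : 1 ≤ l) (hlL : l ≤ L)
    (hγ : Γ.γ = 5 * d / Γ.K * l) (y : Fin d → ℝ) :
    momentForm Γ.rollLaw (Γ.rollFeat i) y y ≤
        14 * L / l * (y ⬝ᵥ (Γ.designMatrix cov i *ᵥ y)) ∧
      momentForm Γ.rollLaw (Γ.rollFeat i) y y + 33 * d * (2 * L) / Γ.K * (y ⬝ᵥ y) ≤
        2 * (14 * L / l) * (y ⬝ᵥ (Γ.designMatrix cov i *ᵥ y)) := by
  have h1 := h.1 y
  have h2 := sampleForm_self_nonneg cov (Γ.rollFeat i) y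
  have h3 := dotProduct_self_nonneg' y
  have hl0 : 0 < l := by linarith
  have h4 : (14 : ℝ) ≤ 14 * L / l := by
    rw [le_div_iff₀ hl0]
    linarith
  have h5 : 14 * L / l * (sampleForm cov (Γ.rollFeat i) y y + Γ.γ * (y ⬝ᵥ y)) =
      14 * L / l * sampleForm cov (Γ.rollFeat i) y y + 70 * (d * L / Γ.K * (y ⬝ᵥ y)) := by
    rw [hγ]
    field_simp
    ring
  have h6 : 33 * d * (2 * L) / Γ.K * (y ⬝ᵥ y) = 66 * (d * L / Γ.K * (y ⬝ᵥ y)) := by ring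
  have h7 : 0 ≤ d * L / Γ.K * (y ⬝ᵥ y) :=
    mul_nonneg (div_nonneg (mul_nonneg (Nat.cast_nonneg _) (by linarith)) (Nat.cast_nonneg _)) h3
  have h8 : 14 * sampleForm cov (Γ.rollFeat i) y y ≤
      14 * L / l * sampleForm cov (Γ.rollFeat i) y y := mul_le_mul_of_nonneg_right h4 h2
  rw [designMatrix_form, mul_assoc 2, h5]
  constructor <;> linarith

/-! ### The estimation error in one direction -/

section Law

variable [∀ i, Fintype (A i)] [∀ i, Nonempty (A i)]

/-- The total estimation error in one direction, under the concentration events. -/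
theorem sum_estimation_error_le (hΓ : Γ.IsBounded) (hd : 0 < d) (hK : 0 < Γ.K) (hH : 0 < H)
    {l L : ℝ} (hl : 1 ≤ l) (hlL : l ≤ L) (hγ : Γ.γ = 5 * d / Γ.K * l) (i : Fin m) (ω : Γ.Run)
    {w : Fin d → ℝ} (hw : w ⬝ᵥ w ≤ d) (hw1 : ∀ s a, Γ.feat i s a ⬝ᵥ w = 1)
    {θ : Fin Γ.K → Fin d → ℝ} (hθ : ∀ k, θ k ⬝ᵥ θ k ≤ (2 * (H : ℝ)) ^ 2 * d)
    (hθq : ∀ k s a, Γ.feat i s a ⬝ᵥ θ k = Γ.qTrue ω k i s a)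
    (hloss : ∀ k, (ω.2.2 k i).loss ∈ Set.Icc (0 : ℝ) 1) (hcov : Γ.CovGood (2 * L) ω.1 i)
    (hround : ∀ y, Γ.scoreDev ω.1 ω.2.1 i y ω.2.2 ^ 2 ≤
      (y ⬝ᵥ (Γ.designMatrix ω.1 i *ᵥ y)) *
        (d * (2 * Real.sqrt (Γ.K * ((H : ℝ) ^ 2 * (14 * L / l)) * (2 * L)) +
          Real.sqrt (1 / Γ.γ) * H * (2 * L)) ^ 2))
    (s : Γ.X) (a : A i) :
    ∑ k, Γ.feat i s a ⬝ᵥ (Γ.thetaHat ω.1 i (ω.2.2 k i) - Γ.thetaTrue ω k i) ≤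
      Γ.K * (1000 * (d * H / Real.sqrt Γ.K) * L *
        (Γ.feat i s a ⬝ᵥ (Γ.sigmaInv ω.1 i *ᵥ Γ.feat i s a))) := by
  have hd' : (1 : ℝ) ≤ d := Nat.one_le_cast.2 hd
  have hK' : (1 : ℝ) ≤ Γ.K := Nat.one_le_cast.2 hK
  have hH' : (1 : ℝ) ≤ H := Nat.one_le_cast.2 hH
  have hγ0 : 0 < Γ.γ := by rw [hγ]; positivity
  set φ := Γ.feat i s a with hφ
  set x := Γ.sigmaInv ω.1 i *ᵥ φ with hx
  set W := Γ.designMatrix ω.1 i with hWdef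
  have hWx : W *ᵥ x = φ := designMatrix_mulVec_sigmaInv hγ0 ω.1 i φ
  have hxWx : x ⬝ᵥ (W *ᵥ x) = φ ⬝ᵥ x := by rw [hWx, dotProduct_comm]
  have hγx : Γ.γ * (x ⬝ᵥ x) ≤ φ ⬝ᵥ x := hxWx ▸ le_designMatrix_form ω.1 i x
  have hxx := dotProduct_self_nonneg' x
  set q := φ ⬝ᵥ x with hq
  have hq0 : 0 ≤ q := (mul_nonneg hγ0.le hxx).trans hγx
  -- The lower bound on q: Cauchy-Schwarz for W applied to x and w, where xᵀWw = φᵀw = 1, obtained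
  -- as the discriminant of r ↦ (rx - w)ᵀW(rx - w).
  have hlow : (Γ.K : ℝ) ≤ q * (Γ.K + 5 * d ^ 2 * l) := by
    have hsq : sampleForm ω.1 (Γ.rollFeat i) w w = 1 := by
      have h1 : ∀ κ, Γ.rollFeat i (ω.1 κ) ⬝ᵥ w = 1 := fun κ => hw1 _ _
      unfold sampleForm
      simp only [dotProduct_comm w, h1]
      simp
      field_simp
    have hww : w ⬝ᵥ (W *ᵥ w) ≤ 1 + Γ.γ * d := by
      rw [hWdef, designMatrix_form, hsq]
      have := mul_le_mul_of_nonneg_left hw hγ0.le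
      linarith
    have hdisc : ∀ r : ℝ, 0 ≤ q * (r * r) + (-2) * r + w ⬝ᵥ (W *ᵥ w) := fun r => by
      have h1 := (mul_nonneg hγ0.le (dotProduct_self_nonneg' _)).trans
        (le_designMatrix_form ω.1 i (r • x - w))
      rw [← hWdef, Matrix.mulVec_sub, Matrix.mulVec_smul, hWx, sub_dotProduct, dotProduct_sub,
        dotProduct_sub, smul_dotProduct, smul_dotProduct, dotProduct_smul, dotProduct_smul,
        dotProduct_comm x φ, dotProduct_comm w φ, hw1] at h1
      have h2 : x ⬝ᵥ (W *ᵥ w) = 1 := by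
        rw [Matrix.dotProduct_mulVec, ← Matrix.mulVec_transpose, hWdef, designMatrix_transpose,
          ← hWdef, hWx, hw1]
      rw [h2] at h1
      simp only [smul_eq_mul] at h1
      rw [← hq] at h1
      linarith
    have h1 := discrim_le_zero hdisc
    rw [discrim] at h1
    have h2 : 1 ≤ q * (1 + Γ.γ * d) := by
      have := mul_le_mul_of_nonneg_left hww hq0
      nlinarith
    rw [hγ] at h2
    have h3 : (Γ.K : ℝ) * (q * (1 + 5 * d / Γ.K * l * d)) = q * (Γ.K + 5 * d ^ 2 * l) := by
      field_simp
    rw [← h3]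
    nlinarith
  have hhat : ∀ k, φ ⬝ᵥ Γ.thetaHat ω.1 i (ω.2.2 k i) = Γ.score i x (ω.2.2 k i) := fun k => by
    rw [thetaHat, dotProduct_smul, dotProduct_sigmaInv_comm, smul_eq_mul, mul_comm]
    rfl
  -- Only the products with features enter, so the arbitrarily chosen parameter may be replaced by
  -- the one of bounded norm.
  have htrue : ∀ k, φ ⬝ᵥ Γ.thetaTrue ω k i = φ ⬝ᵥ θ k := fun k => by
    have h : ∃ θ : Fin d → ℝ, ∀ s a, Γ.feat i s a ⬝ᵥ θ = Γ.qTrue ω k i s a := ⟨θ k, hθq k⟩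
    rw [hθq]
    exact Classical.epsilon_spec h s a
  have hrange : ∀ k s a, 0 ≤ Γ.feat i s a ⬝ᵥ θ k ∧ Γ.feat i s a ⬝ᵥ θ k ≤ H := fun k s a => by
    rw [hθq]
    exact hΓ.pmfExp_backup_mem i _ s a
  set B := 1000 * (d * H / Real.sqrt Γ.K) * L * q with hB
  have hconst : ∑ _k : Fin Γ.K, B = Γ.K * B := by simp
  simp only [dotProduct_sub, hhat, htrue]
  -- For K ≤ d each round is bounded separately, discarding the nonnegative φᵀθₖ. For d ≤ K half of
  -- the budget KB goes to the martingale and half to the drift.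
  rcases le_total (Γ.K : ℝ) d with hKd | hKd
  · rw [← hconst]
    refine Finset.sum_le_sum fun k _ => ?_
    refine (sub_le_self _ (hrange k s a).1).trans
      (crude_le_rate hd' hK' hH' hl hlL hq0 hlow hKd ?_)
    have h1 := hΓ.ret_mem i (hloss k)
    rw [score, mul_pow, mul_comm, ← hγ]
    refine mul_le_mul (pow_le_pow_left₀ h1.1 h1.2 2) ((dotProduct_sq_le _ _).trans ?_)
      (sq_nonneg _) (sq_nonneg _)
    rw [le_div_iff₀ hγ0]
    have h2 := mul_le_mul_of_nonneg_left (hΓ.feat_le i (ω.2.2 k i).state (ω.2.2 k i).action) hxx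
    nlinarith
  · have hmean : ∀ k, Γ.scoreMean (Γ.prefixPolicy ω.1 ω.2.1 ω.2.2 k) i x =
        momentForm Γ.rollLaw (Γ.rollFeat i) x (θ k) := fun k =>
      hΓ.scoreMean_eq i _ x (θ k) fun s a => hθq k s a
    have hS : Γ.scoreDev ω.1 ω.2.1 i x ω.2.2 ≤ Γ.K / 2 * B := by
      refine martingale_le_rate hd' hK' hH' hl hlL hq0 hlow hKd ?_
      have h1 := hround x
      rw [hxWx] at h1
      rwa [← hγ]
    have hdom := hcov.momentForm_le hl hlL hγ x
    rw [← hWdef, hxWx] at hdom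
    have hbias : ∀ k, momentForm Γ.rollLaw (Γ.rollFeat i) x (θ k) - φ ⬝ᵥ θ k ≤ 1 / 2 * B := by
      intro k
      rcases le_total (Γ.K : ℝ) ((d : ℝ) ^ 2) with hKd2 | hKd2
      · refine (sub_le_self _ (hrange k s a).1).trans
          (drift_le_rate hd' hK' hH' hl hlL hq0 hlow hKd2 ?_)
        refine (momentForm_sq_le _ (hΓ.isBddVec_rollFeat i)
          (fun z => hrange k z.1 (z.2 i)) x).trans ?_
        exact mul_le_mul_of_nonneg_right hdom.1 (sq_nonneg _)
      -- φ = Wx splits the drift into sampling and regularisation errors, each allotted B/4.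
      · have h1 : φ ⬝ᵥ θ k = sampleForm ω.1 (Γ.rollFeat i) x (θ k) + Γ.γ * (x ⬝ᵥ θ k) := by
          rw [← designMatrix_form, ← hWdef, Matrix.dotProduct_mulVec, ← Matrix.mulVec_transpose,
            hWdef, designMatrix_transpose, ← hWdef, hWx]
        have h2 : momentForm Γ.rollLaw (Γ.rollFeat i) x (θ k) -
            sampleForm ω.1 (Γ.rollFeat i) x (θ k) ≤ 1 / 4 * B := by
          refine sampling_le_rate hd' hK' hH' hl hlL hq0 hlow hKd2 ((hcov.2 x (θ k)).trans ?_)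
          have hL0 : 0 ≤ L := by linarith
          have h0 : (0 : ℝ) ≤ 9 * d * (2 * L) / Γ.K := by positivity
          refine mul_le_mul (mul_le_mul_of_nonneg_left (hθ k) h0) hdom.2 ?_ (by positivity)
          have := momentForm_self_nonneg Γ.rollLaw (Γ.rollFeat i) x
          positivity
        have h3 : -(Γ.γ * (x ⬝ᵥ θ k)) ≤ 1 / 4 * B := by
          refine regularisation_le_rate hd' hK' hH' hl hlL hq0 hlow hKd2 ?_
          rw [← hγ]
          calc (-(Γ.γ * (x ⬝ᵥ θ k))) ^ 2 = Γ.γ ^ 2 * (x ⬝ᵥ θ k) ^ 2 := by ring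
            _ ≤ Γ.γ ^ 2 * ((x ⬝ᵥ x) * (θ k ⬝ᵥ θ k)) :=
                mul_le_mul_of_nonneg_left (dotProduct_sq_le _ _) (sq_nonneg _)
            _ = Γ.γ * (Γ.γ * (x ⬝ᵥ x)) * (θ k ⬝ᵥ θ k) := by ring
            _ ≤ Γ.γ * q * ((2 * H) ^ 2 * d) := by
                refine mul_le_mul (mul_le_mul_of_nonneg_left hγx hγ0.le) (hθ k)
                  (dotProduct_self_nonneg' _) (mul_nonneg hγ0.le hq0)
        linarith
    have hsplit : ∑ k, (Γ.score i x (ω.2.2 k i) - φ ⬝ᵥ θ k) =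
        Γ.scoreDev ω.1 ω.2.1 i x ω.2.2 +
          ∑ k, (momentForm Γ.rollLaw (Γ.rollFeat i) x (θ k) - φ ⬝ᵥ θ k) := by
      rw [scoreDev, ← Finset.sum_add_distrib]
      refine Finset.sum_congr rfl fun k _ => ?_
      rw [hmean]
      ring
    have hsum := Finset.sum_le_sum fun k (_ : k ∈ Finset.univ) => hbias k
    rw [← Finset.mul_sum, hconst] at hsum
    rw [hsplit]
    linarith

end Law

end CCECall

namespace CCECall

variable {m d H : ℕ} {S : Fin (H + 1) → Type u} {A : Fin m → Type v} {Γ : CCECall m d H S A}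
  [∀ i, Fintype (A i)] [∀ i, Nonempty (A i)]

/-! ### The probability bound -/

/-- Recorded losses are unrestricted reals as data; they lie in [0, 1] only on executions of
positive probability. -/
theorem loss_mem_of_mem_support (cov mag : Γ.Batch) {k : ℕ} {o : Fin k → Γ.Round}
    (ho : o ∈ (Γ.roundsLaw cov mag k).support) (κ : Fin k) (i : Fin m) :
    (o κ i).loss ∈ Set.Icc (0 : ℝ) 1 := by
  induction k with
  | zero => exact κ.elim0
  | succ k ih =>
    rw [roundsLaw, PMF.mem_support_bind_iff] at ho
    obtain ⟨o', ho', h⟩ := ho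
    rw [PMF.mem_support_map_iff] at h
    obtain ⟨r, hr, rfl⟩ := h
    refine Fin.lastCases ?_ (fun κ => ?_) κ
    · rw [Fin.snoc_last (α := fun _ => Γ.Round)]
      have h1 := pmfPi_support_apply _ hr i
      rw [obsLaw_eq_map, PMF.mem_support_map_iff] at h1
      obtain ⟨e, -, he⟩ := h1
      rw [← he]
      exact Γ.game.loss_mem _ _ _ _
    · rw [Fin.snoc_castSucc (α := fun _ => Γ.Round)]
      exact ih ho' κ

/-- The estimates of the learning rounds are close to their predictable parts. -/
def RoundsGood (Γ : CCECall m d H S A) (l L : ℝ) (cov mag : Γ.Batch) (i : Fin m)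
    (o : Fin Γ.K → Γ.Round) : Prop :=
  ∀ y, Γ.scoreDev cov mag i y o ^ 2 ≤ (y ⬝ᵥ (Γ.designMatrix cov i *ᵥ y)) *
    (d * (2 * Real.sqrt (Γ.K * ((H : ℝ) ^ 2 * (14 * L / l)) * (2 * L)) +
      Real.sqrt (1 / Γ.γ) * H * (2 * L)) ^ 2)

/-- An event that contains all supported executions with good concentration has high
probability. -/
theorem toOuterMeasure_compl_le (hΓ : Γ.IsBounded) (hd : 0 < d) (hK : 0 < Γ.K) (hH : 0 < H)
    {l L : ℝ} (hl : 1 ≤ l) (hlL : l ≤ L) (hγ : Γ.γ = 5 * d / Γ.K * l) (E : Set Γ.Run)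
    (hE : ∀ ω ∈ Γ.runLaw.support, (∀ i, Γ.CovGood (2 * L) ω.1 i) →
      (∀ i, Γ.RoundsGood l L ω.1 ω.2.1 i ω.2.2) → ω ∈ E) :
    Γ.runLaw.toOuterMeasure Eᶜ ≤
      m * (4 * d ^ 2 * ENNReal.ofReal (Real.exp (-(2 * L)))) +
        m * (d * (2 * ENNReal.ofReal (Real.exp (-(2 * L))))) := by
  have hL : 0 < 2 * L := by linarith
  have hd' : (0 : ℝ) < d := Nat.cast_pos.2 hd
  have hK' : (0 : ℝ) < Γ.K := Nat.cast_pos.2 hK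
  have hγ0 : 0 < Γ.γ := by rw [hγ]; positivity
  rw [← PMF.toOuterMeasure_apply_inter_support]
  have hcov : (pmfPi fun _ : Fin Γ.K => Γ.rollLaw).toOuterMeasure
      (⋃ i, {cov | ¬ Γ.CovGood (2 * L) cov i}) ≤
      m * (4 * d ^ 2 * ENNReal.ofReal (Real.exp (-(2 * L)))) := by
    have := toOuterMeasure_iUnion_le (pmfPi fun _ : Fin Γ.K => Γ.rollLaw)
      (fun i => {cov : Γ.Batch | ¬ Γ.CovGood (2 * L) cov i}) fun i =>
      sampleForm_concentration (K := Γ.K) Γ.rollLaw hL hK hd (hΓ.rollFeat_le i)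
    rwa [Fintype.card_fin] at this
  refine toOuterMeasure_bind_le _ _ _ _ hcov fun cov hgood => ?_
  -- No requirement is imposed on the magnitude batch: its bad set is empty.
  refine (toOuterMeasure_bind_le _ _ _ ∅ (a := 0) (by simp) fun mag _ => ?_).trans_eq (zero_add _)
  rw [PMF.toOuterMeasure_map_apply]
  have hgood' : ∀ i, Γ.CovGood (2 * L) cov i := fun i => by
    by_contra h
    exact hgood (Set.mem_iUnion.2 ⟨i, h⟩)
  have hround := toOuterMeasure_iUnion_le (Γ.roundsLaw cov mag Γ.K)
    (fun i => {o | ¬ Γ.RoundsGood l L cov mag i o}) fun i =>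
    scoreDev_concentration hΓ hH cov mag i (posDef_designMatrix hγ0 cov i) hγ0 hL
      (le_designMatrix_form cov i) (fun y => ((hgood' i).momentForm_le hl hlL hγ y).1) Γ.K
  rw [Fintype.card_fin] at hround
  refine (MeasureTheory.measure_mono ?_).trans hround
  rintro o ⟨ho, hsupp⟩
  by_contra h
  refine ho (hE _ hsupp hgood' fun i => ?_)
  by_contra hi
  exact h (Set.mem_iUnion.2 ⟨i, hi⟩)

theorem mem_support_roundsLaw {ω : Γ.Run} (hω : ω ∈ Γ.runLaw.support) :
    ω.2.2 ∈ (Γ.roundsLaw ω.1 ω.2.1 Γ.K).support := by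
  rw [runLaw, PMF.mem_support_bind_iff] at hω
  obtain ⟨cov, -, hω⟩ := hω
  rw [PMF.mem_support_bind_iff] at hω
  obtain ⟨mag, -, hω⟩ := hω
  rw [PMF.mem_support_map_iff] at hω
  obtain ⟨o, ho, rfl⟩ := hω
  exact ho

theorem bias2_add_bonus2_le {ω : Γ.Run} {i : Fin m} {s : Γ.X}
    (h : ∀ a, ∑ k, Γ.feat i s a ⬝ᵥ (Γ.thetaHat ω.1 i (ω.2.2 k i) - Γ.thetaTrue ω k i) ≤
      Γ.K * Γ.bonus ω.1 i s a) (πstar : PMF (A i)) :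
    Γ.bias2 ω i s πstar + Γ.bonus2 ω i s πstar ≤ 0 := by
  have h1 : Γ.bias2 ω i s πstar = ∑ a, (πstar a).toReal *
      ∑ k, Γ.feat i s a ⬝ᵥ (Γ.thetaHat ω.1 i (ω.2.2 k i) - Γ.thetaTrue ω k i) := by
    rw [bias2, Finset.sum_comm]
    exact Finset.sum_congr rfl fun a _ => (Finset.mul_sum _ _ _).symm
  have h2 : Γ.bonus2 ω i s πstar = -∑ a, (πstar a).toReal * (Γ.K * Γ.bonus ω.1 i s a) := by
    rw [bonus2, Finset.sum_const, Finset.card_univ, Fintype.card_fin, nsmul_eq_mul,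
      Finset.mul_sum]
    congr 1
    exact Finset.sum_congr rfl fun a _ => by ring
  rw [h1, h2, ← sub_eq_add_neg, sub_nonpos]
  exact Finset.sum_le_sum fun a _ => mul_le_mul_of_nonneg_left (h a) ENNReal.toReal_nonneg

end CCECall

/-- Since L is the logarithm of 6mdHK/δ, e⁻²ᴸ is the square of its inverse argument. It pays for the
union over agents and d² entries, leaving at most δ²/6. -/
theorem failure_probability_le {m d H K : ℕ} {δ : ℝ} (hm : 0 < m) (hd : 0 < d) (hH : 0 < H)
    (hK : 0 < K) (hδ : 0 < δ) (hδ1 : δ < 1) :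
    (m : ℝ≥0∞) * (4 * d ^ 2 * ENNReal.ofReal (Real.exp
        (-(2 * Real.log (6 * m * d * H * K / δ))))) +
      m * (d * (2 * ENNReal.ofReal (Real.exp (-(2 * Real.log (6 * m * d * H * K / δ)))))) ≤
      ENNReal.ofReal (2 * δ) := by
  have hm' : (1 : ℝ) ≤ m := Nat.one_le_cast.2 hm
  have hd' : (1 : ℝ) ≤ d := Nat.one_le_cast.2 hd
  have hH' : (1 : ℝ) ≤ H := Nat.one_le_cast.2 hH
  have hK' : (1 : ℝ) ≤ K := Nat.one_le_cast.2 hK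
  have hx : 0 < 6 * m * d * H * K / δ := by positivity
  set e := Real.exp (-(2 * Real.log (6 * m * d * H * K / δ))) with he
  have he1 : e = (δ / (6 * m * d * H * K)) ^ 2 := by
    rw [he, Real.exp_neg, two_mul, Real.exp_add, Real.exp_log hx, ← sq, ← inv_pow, inv_div]
  have he0 : 0 ≤ e := (Real.exp_pos _).le
  have h1 : (m : ℝ≥0∞) * (4 * d ^ 2 * ENNReal.ofReal e) + m * (d * (2 * ENNReal.ofReal e)) =
      ENNReal.ofReal (m * (4 * d ^ 2 * e) + m * (d * (2 * e))) := by
    rw [ENNReal.ofReal_add (by positivity) (by positivity), ENNReal.ofReal_mul (by positivity),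
      ENNReal.ofReal_mul (by positivity), ENNReal.ofReal_mul (by positivity),
      ENNReal.ofReal_mul (by positivity), ENNReal.ofReal_mul (by positivity),
      ENNReal.ofReal_mul (by positivity), ENNReal.ofReal_pow (by positivity)]
    simp
  rw [h1]
  refine ENNReal.ofReal_le_ofReal ?_
  have h2 : m * (4 * d ^ 2 * e) + m * (d * (2 * e)) ≤ 6 * m ^ 2 * d ^ 2 * H ^ 2 * K ^ 2 * e := by
    have a1 : (m : ℝ) * (4 * d ^ 2 * e) + m * (d * (2 * e)) ≤ 6 * (m * d ^ 2 * e) := by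
      have : (m : ℝ) * (d * (2 * e)) ≤ 2 * (m * d ^ 2 * e) := by
        have : (m : ℝ) * e * d ≤ m * e * d ^ 2 :=
          mul_le_mul_of_nonneg_left (by nlinarith) (by positivity)
        linarith
      linarith
    have a2 : (m : ℝ) * d ^ 2 * e ≤ m ^ 2 * d ^ 2 * H ^ 2 * K ^ 2 * e := by
      refine mul_le_mul_of_nonneg_right ?_ he0
      calc (m : ℝ) * d ^ 2 = m * d ^ 2 * 1 * 1 := by ring
        _ ≤ (m : ℝ) ^ 2 * (d : ℝ) ^ 2 * (H : ℝ) ^ 2 * (K : ℝ) ^ 2 := by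
          gcongr
          · nlinarith
          · exact one_le_pow₀ hH'
          · exact one_le_pow₀ hK'
    linarith
  refine h2.trans ?_
  have h3 : 6 * m ^ 2 * d ^ 2 * H ^ 2 * K ^ 2 * e = δ * (δ / 6) := by
    rw [he1]
    field_simp
  rw [h3]
  nlinarith

theorem mainTheorem5 :
    ∃ c C : ℝ, 0 < c ∧ 0 < C ∧
      ∀ (m d H : ℕ) (S : Fin (H + 1) → Type u) (A : Fin m → Type v)
        [∀ i, Fintype (A i)] [∀ i, Nonempty (A i)]
        (Γ : CCECall m d H S A)
        (Pest : ∀ h : Fin H, Set (LayerPolicy (S h.castSucc) A)),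
        0 < d → 0 < Γ.K → 0 < Γ.δ → Γ.δ < 1 →
        (∀ i y, 0 ≤ Γ.Vbar i y ∧ Γ.Vbar i y ≤ (H : ℝ) - ((Γ.h : ℕ) + 1)) →
        Γ.game.IndependentLinear Γ.φ Pest →
        (∀ ω ∈ Γ.runLaw.support, ∀ k, Γ.policyAt ω k ∈ Pest Γ.h) →
        c * (d * H / Real.sqrt Γ.K) * Real.log (6 * m * d * H * Γ.K / Γ.δ) ≤ Γ.β₁ →
        c * (H / Γ.K) * Real.log (6 * m * d * H * Γ.K / Γ.δ) ≤ Γ.β₂ →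
        ENNReal.ofReal (1 - 2 * Γ.δ) ≤
          Γ.runLaw.toOuterMeasure
            {ω | ∀ (i : Fin m) (s : Γ.X) (πstar : PMF (A i)),
              Γ.bias2 ω i s πstar + Γ.bonus2 ω i s πstar
                ≤ C * (d / Γ.β₁) * Real.log (d * Γ.K / Γ.δ)} := by
  -- Any positive C works, because the left side is shown to be nonpositive; 1000 is the constant of
  -- the rate.
  refine ⟨1000, 1, by norm_num, one_pos, ?_⟩
  intro m d H S A _ _ Γ Pest hd hK hδ hδ1 hV hG hPest hβ₁ hβ₂
  have hH : 0 < H := Γ.h.pos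
  have hd' : (1 : ℝ) ≤ d := Nat.one_le_cast.2 hd
  have hK' : (1 : ℝ) ≤ Γ.K := Nat.one_le_cast.2 hK
  have hH' : (1 : ℝ) ≤ H := Nat.one_le_cast.2 hH
  set E : Set Γ.Run := {ω | ∀ (i : Fin m) (s : Γ.X) (πstar : PMF (A i)),
    Γ.bias2 ω i s πstar + Γ.bonus2 ω i s πstar
      ≤ 1 * (d / Γ.β₁) * Real.log (d * Γ.K / Γ.δ)} with hE
  suffices h : Γ.runLaw.toOuterMeasure Eᶜ ≤ ENNReal.ofReal (2 * Γ.δ) by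
    rw [ENNReal.ofReal_sub _ (by linarith), ENNReal.ofReal_one,
      ← toOuterMeasure_add_compl Γ.runLaw E]
    exact tsub_le_iff_right.2 (add_le_add_right h _)
  rcases Nat.eq_zero_or_pos m with rfl | hm
  · have : Eᶜ = ∅ := Set.compl_empty_iff.2 (Set.eq_univ_of_forall fun ω i => i.elim0)
    rw [this]
    simp
  have hm' : (1 : ℝ) ≤ m := Nat.one_le_cast.2 hm
  have hΓ := CCECall.isBounded_of_independentLinear hV hG
  set l := Real.log (6 * d / Γ.δ) with hl_def
  set L := Real.log (6 * m * d * H * Γ.K / Γ.δ) with hL_def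
  have hdδ : 6 ≤ 6 * d / Γ.δ := by
    rw [le_div_iff₀ hδ]
    nlinarith
  have hl : 1 ≤ l := by
    rw [hl_def, Real.le_log_iff_exp_le (by linarith)]
    linarith [Real.exp_one_lt_d9]
  have hlL : l ≤ L := by
    refine Real.log_le_log (by linarith) (div_le_div_of_nonneg_right ?_ hδ.le)
    have h1 : (1 : ℝ) ≤ m * H * Γ.K := one_le_mul_of_one_le_of_one_le
      (one_le_mul_of_one_le_of_one_le hm' hH') hK'
    have h2 : (6 : ℝ) * m * d * H * Γ.K = 6 * d * (m * H * Γ.K) := by ring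
    rw [h2]
    exact le_mul_of_one_le_right (by linarith) h1
  have hL : 0 < L := by linarith
  have hγ : Γ.γ = 5 * d / Γ.K * l := rfl
  have hγ0 : 0 < Γ.γ := by rw [hγ]; positivity
  have hβ₁0 : 0 < Γ.β₁ := lt_of_lt_of_le (by positivity) hβ₁
  have hβ₂0 : 0 ≤ Γ.β₂ := le_trans (by positivity) hβ₂
  have hrhs : 0 ≤ 1 * (d / Γ.β₁) * Real.log (d * Γ.K / Γ.δ) := by
    refine mul_nonneg (by positivity) (Real.log_nonneg ?_)
    rw [le_div_iff₀ hδ]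
    nlinarith
  refine (CCECall.toOuterMeasure_compl_le hΓ hd hK hH hl hlL hγ E
    fun ω hω hcov hround i s πstar => ?_).trans (failure_probability_le hm hd hH hK hδ hδ1)
  -- Any admissible policy provides such a w; the first round exists because K ≥ 1.
  obtain ⟨w, hw, hw1⟩ := CCECall.exists_unit_vector hG i (hPest ω hω ⟨0, hK⟩)
  choose θ hθ hθq using fun k => CCECall.exists_parameter hΓ hH hG i (hPest ω hω k)
  refine (CCECall.bias2_add_bonus2_le (fun a => ?_) πstar).trans hrhs
  refine (CCECall.sum_estimation_error_le hΓ hd hK hH hl hlL hγ i ω hw hw1 hθ hθq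
    (fun k => CCECall.loss_mem_of_mem_support _ _ (CCECall.mem_support_roundsLaw hω) k i)
    (hcov i) (hround i) s a).trans ?_
  refine mul_le_mul_of_nonneg_left (le_trans ?_ (CCECall.le_bonus hΓ hγ0 hβ₂0 ω.1 i s a))
    (Nat.cast_nonneg _)
  exact mul_le_mul_of_nonneg_right hβ₁ (CCECall.sigmaInv_form_nonneg hγ0 ω.1 i _)

end
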